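/- Let $p>2$ be a prime, let $q=p^r$ with $r\ge 2$, and let $C\subset\mathbb{P}^2$ be a smooth plane curve of degree $d$ defined over $\mathbb{F}_q$, where $d=p+1$ or $d=2p+1$. Let $\varphi\colon C\to(\mathbb{P}^2)^*$ be the Gauss map, sending a point of $C$ to the tangent line of $C$ there, and let $C^*$, the dual curve, be the Zariski closure of its image. Let $\varphi'$ be the Gauss map of $C^*$ (defined at the smooth points of $C^*$), and let $C^{**}$ be the closure of its image in $(\mathbb{P}^2)^{**}=\mathbb{P}^2$. The curve $C$ is called reflexive if $C^{**}=C$ and $\varphi'\circ\varphi$ is the identity wherever it is defined (all of this over the algebraic closure $\overline{\mathbb{F}}_q$). If $C$ is not reflexive, then there is a line $L\subset\mathbb{P}^2$ defined over $\mathbb{F}_q$ that meets $C$ transversely, i.e. such that $C\cap L$ consists of exactly $d$ distinct points over $\overline{\mathbb{F}}_q$. -/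

import Mathlib

open MvPolynomial
open scoped LinearAlgebra.Projectivization

/-- The projective plane over `K`, as the set of its `K`-points: lines through the origin in `K³`.
Via the standard dot product the same type serves as the dual plane: `ℓ` stands for the line
`{P | ℓ ⬝ᵥ P = 0}`. In particular the plane is identified with its double dual. -/
abbrev Plane (K : Type*) [Field K] : Type _ := ℙ K (Fin 3 → K)

/-- A projective plane curve of degree `d` defined over `k`, given by a nonzero form of degree `d`
in three variables. -/
structure PlaneCurve (k : Type*) [Field k] (d : ℕ) where
  /-- the defining equation -/
  form : MvPolynomial (Fin 3) k
  isHomogeneous : form.IsHomogeneous d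
  ne_zero : form ≠ 0

namespace Plane

variable {K : Type*} [Field K]

/-- The polynomial `G` vanishes at every point of `X` (used for homogeneous `G`, for which this
does not depend on the chosen homogeneous coordinates). -/
def VanishesOn (G : MvPolynomial (Fin 3) K) (X : Set (Plane K)) : Prop :=
  ∀ P ∈ X, eval P.rep G = 0

/-- The closure of `X` in the Zariski topology of the projective plane. -/
def zariskiClosure (X : Set (Plane K)) : Set (Plane K) :=
  {P | ∀ (n : ℕ) (G : MvPolynomial (Fin 3) K),
    G.IsHomogeneous n → VanishesOn G X → eval P.rep G = 0}

/-- The (embedded, projective) Zariski tangent space at `P` of the reduced closed set `X`, as a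
linear subspace of `K³`: the common kernel of the differentials at `P` of all forms that
vanish on `X`. If `X` is a curve, then `P` is a smooth point of `X` exactly when this subspace has
dimension two, that is, when it is a projective line. -/
def tangentSpace (X : Set (Plane K)) (P : Plane K) : Submodule K (Fin 3 → K) where
  carrier := {v | ∀ (n : ℕ) (G : MvPolynomial (Fin 3) K),
    G.IsHomogeneous n → VanishesOn G X → (fun i => eval P.rep (pderiv i G)) ⬝ᵥ v = 0}
  zero_mem' := by
    intro n G _ _
    simp
  add_mem' := by
    intro v w hv hw n G hG hX
    rw [dotProduct_add, hv n G hG hX, hw n G hG hX, add_zero]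
  smul_mem' := by
    intro c v hv n G hG hX
    rw [dotProduct_smul, hv n G hG hX, smul_zero]

/-- The graph of the Gauss map of `X`: `P` is a smooth point of the curve `X`, and the line with
coordinates `ℓ` is the tangent line of `X` at `P`. -/
def IsGaussImage (X : Set (Plane K)) (P ℓ : Plane K) : Prop :=
  P ∈ X ∧ ∀ v : Fin 3 → K, v ∈ tangentSpace X P ↔ ℓ.rep ⬝ᵥ v = 0

/-- The dual curve of `X`: the closure of the image of the Gauss map of `X`. -/
def dualCurve (X : Set (Plane K)) : Set (Plane K) :=
  zariskiClosure {ℓ | ∃ P, IsGaussImage X P ℓ}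

/-- `X` is reflexive: it equals its bidual, and the composition of the Gauss map of `X` with the
Gauss map of the dual curve is the identity (where that composition is defined). -/
def IsReflexive (X : Set (Plane K)) : Prop :=
  dualCurve (dualCurve X) = X ∧
    ∀ P ℓ Q : Plane K, IsGaussImage X P ℓ → IsGaussImage (dualCurve X) ℓ Q → Q = P

end Plane

namespace PlaneCurve

variable {k : Type*} [Field k] {d : ℕ}

/-- The geometric points of the curve `C`. -/
def geomPoints (C : PlaneCurve k d) : Set (Plane (AlgebraicClosure k)) :=
  {P | aeval P.rep C.form = 0}

/-- `C` is smooth: at no geometric point of `C` do all partial derivatives vanish. -/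
def IsSmooth (C : PlaneCurve k d) : Prop :=
  ∀ P ∈ C.geomPoints, ∃ i, aeval P.rep (pderiv i C.form) ≠ 0

/-- `C` is reflexive (as a curve over the algebraic closure of `k`). -/
def IsReflexive (C : PlaneCurve k d) : Prop :=
  Plane.IsReflexive C.geomPoints

/-- The geometric points of the line over `k` with equation `a₀ x + a₁ y + a₂ z = 0`. -/
def lineGeomPoints (a : Fin 3 → k) : Set (Plane (AlgebraicClosure k)) :=
  {P | (fun i => algebraMap k (AlgebraicClosure k) (a i)) ⬝ᵥ P.rep = 0}

/-- The line `a₀ x + a₁ y + a₂ z = 0` meets `C` transversely: their intersection consists of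
exactly `d = deg C` distinct geometric points. -/
def MeetsTransversely (C : PlaneCurve k d) (a : Fin 3 → k) : Prop :=
  (C.geomPoints ∩ lineGeomPoints a).encard = d

end PlaneCurve

/-! Let F be the equation of C over the algebraic closure. In both cases d ≡ 1 mod p, and smoothness
makes F irreducible, since two factors would meet in a singular point. Call F flat if its Hessian
form vanishes on every tangent line, that is, if the Gauss map has zero differential.

Not flat implies reflexive (`Plane.isReflexive_zeros`). If a form G vanishes on the dual curve, then
G(∇F) = F·E. Differentiating this along C shows that ∇G(∇F(v)) is orthogonal to Hess(v)q for every
tangent direction q at v. Where q·Hess(v)q ≠ 0 this forces ∇G(∇F(v)) to be a multiple of v, and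
irreducibility spreads the conclusion over all of C. So the tangent line of the dual curve at the
image of v is v itself. A form G of least degree with F ∣ G(∇F) ensures that some such gradient is
generically nonzero. Hence a non-reflexive C is flat.

Flatness makes tangency expensive (`MvPolynomial.IsFlat.pow_dvd_restrictLine`). Every tangent line
has contact of order at least p, and the direction of ∇F is constant along it modulo the p-th power
of the parameter. If the tangent at P passes through R, then the polar curve R·∇F = 0, of degree d -
1, also has contact p with this tangent at P. By Bézout, at most d(d-1)/p points of C have their
tangent through R. A tangent line also has at most d - p + 1 points in common with C.

Now suppose that no line over 𝔽_q is transverse, so each has at least one point of tangency. If it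
has only one, Frobenius fixes that point, which is therefore rational, and it determines the line.
Hence the number of tangencies plus the number of rational points of C is at least twice the number
of lines. Averaging over the rational points R and over the rational lines gives 2p(q+1) ≤ d(d-1) +
p(d-p+1), which is false for q ≥ p² and the two degrees. -/

section CommonZero

/-! ### Chain rule, and common zeros of two polynomials in three variables -/

variable {K : Type*} [Field K]

/-- The chain rule for a derivation applied to a polynomial expression. -/
theorem MvPolynomial.derivation_aeval {σ A : Type*} [Fintype σ] [CommRing A] [Algebra K A]
    (D : Derivation K A A) (f : σ → A) (G : MvPolynomial σ K) :
    D (aeval f G) = ∑ i, aeval f (pderiv i G) * D (f i) := by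
  classical
  induction G using MvPolynomial.induction_on with
  | C a => simp
  | add p q hp hq => simp [hp, hq, add_mul, Finset.sum_add_distrib]
  | mul_X p i hp =>
    have h : ∀ j, aeval f (pderiv j (p * X i)) * D (f j) =
        f i * (aeval f (pderiv j p) * D (f j)) + (if j = i then aeval f p * D (f i) else 0) := by
      intro j
      rw [pderiv_mul, pderiv_X]
      by_cases hj : j = i
      · subst hj; simp; ring
      · simp [hj, Ne.symm hj]; ring
    rw [Finset.sum_congr rfl fun j _ => h j, Finset.sum_add_distrib, ← Finset.mul_sum, ← hp]
    simp [mul_comm]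

/-- The ideal of the origin of affine three-space has height at least three. -/
theorem MvPolynomial.three_le_height_vanishingIdeal_zero :
    3 ≤ (RingHom.ker (eval (0 : Fin 3 → K))).height := by
  let f₁ : MvPolynomial (Fin 3) K →ₐ[K] MvPolynomial (Fin 3) K := aeval ![0, X 1, X 2]
  let f₂ : MvPolynomial (Fin 3) K →ₐ[K] MvPolynomial (Fin 3) K := aeval ![0, 0, X 2]
  let I₁ := RingHom.ker f₁.toRingHom
  let I₂ := RingHom.ker f₂.toRingHom
  let I₃ := RingHom.ker (eval (0 : Fin 3 → K))
  have h₁ : I₁.IsPrime := RingHom.ker_isPrime _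
  have h₂ : I₂.IsPrime := RingHom.ker_isPrime _
  have h₃ : I₃.IsPrime := RingHom.ker_isPrime _
  have h01 : (⊥ : Ideal (MvPolynomial (Fin 3) K)) < I₁ := by
    rw [bot_lt_iff_ne_bot]
    intro h
    have : (X 0 : MvPolynomial (Fin 3) K) ∈ I₁ := by simp [I₁, f₁, RingHom.mem_ker]
    rw [h] at this
    simp at this
  have h12 : I₁ < I₂ := by
    refine lt_of_le_of_ne ?_ ?_
    · intro x hx
      have hx' : f₁ x = 0 := hx
      have : f₂ x = f₂ (f₁ x) := by
        have e : f₂ = f₂.comp f₁ := by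
          ext i; fin_cases i <;> simp [f₁, f₂]
        exact congrArg (fun g => g x) e
      show f₂ x = 0
      rw [this, hx', map_zero]
    · intro h
      have : (X 1 : MvPolynomial (Fin 3) K) ∈ I₂ := by simp [I₂, f₂, RingHom.mem_ker]
      rw [← h] at this
      have h' : f₁ (X 1) = 0 := this
      simp [f₁] at h'
  have h23 : I₂ < I₃ := by
    refine lt_of_le_of_ne ?_ ?_
    · intro x hx
      have hx' : f₂ x = 0 := hx
      have : (aeval (0 : Fin 3 → K)) x = (aeval (0 : Fin 3 → K)) (f₂ x) := by
        have e : (aeval (0 : Fin 3 → K) : MvPolynomial (Fin 3) K →ₐ[K] K) =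
            (aeval (0 : Fin 3 → K)).comp f₂ := by
          ext i; fin_cases i <;> simp [f₂]
        exact congrArg (fun g => g x) e
      rw [hx', map_zero] at this
      exact this
    · intro h
      have : (X 2 : MvPolynomial (Fin 3) K) ∈ I₃ := by simp [I₃, RingHom.mem_ker]
      rw [← h] at this
      have h' : f₂ (X 2) = 0 := this
      simp [f₂] at h'
  have a1 := Ideal.height_add_one_le_of_lt_of_isPrime h01
  have a2 := Ideal.height_add_one_le_of_lt_of_isPrime h12
  have a3 := Ideal.height_add_one_le_of_lt_of_isPrime h23
  calc (3 : ℕ∞) = 0 + 1 + 1 + 1 := by norm_num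
    _ ≤ (⊥ : Ideal (MvPolynomial (Fin 3) K)).height + 1 + 1 + 1 := by gcongr; exact zero_le
    _ ≤ I₁.height + 1 + 1 := by gcongr
    _ ≤ I₂.height + 1 := by gcongr
    _ ≤ _ := a3

/-- Two polynomials in three variables vanishing at the origin have another common zero. -/
theorem MvPolynomial.exists_common_zero [IsAlgClosed K] {A B : MvPolynomial (Fin 3) K}
    (hA : eval 0 A = 0) (hB : eval 0 B = 0) :
    ∃ v : Fin 3 → K, v ≠ 0 ∧ eval v A = 0 ∧ eval v B = 0 := by
  by_contra! h
  have hz : zeroLocus K (Ideal.span {A, B}) = {0} := by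
    ext v
    rw [zeroLocus_span]
    simp only [Set.mem_insert_iff, Set.mem_singleton_iff, forall_eq_or_imp, forall_eq,
      Set.mem_ofPred_eq]
    constructor
    · rintro ⟨h1, h2⟩
      by_contra hv
      exact h v hv h1 h2
    · rintro rfl
      exact ⟨hA, hB⟩
  have hr : (Ideal.span {A, B}).radical = RingHom.ker (eval (0 : Fin 3 → K)) := by
    rw [← vanishingIdeal_zeroLocus_eq_radical (K := K), hz]
    ext x
    rw [mem_vanishingIdeal_singleton_iff, RingHom.mem_ker]
    rfl
  have hm : RingHom.ker (eval (0 : Fin 3 → K)) ∈ (Ideal.span {A, B}).minimalPrimes := by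
    have : (RingHom.ker (eval (0 : Fin 3 → K))).IsPrime := RingHom.ker_isPrime _
    rw [← Ideal.radical_minimalPrimes, hr, Ideal.minimalPrimes_eq_subsingleton_self]
    rfl
  have h2 := Ideal.height_le_card_of_mem_minimalPrimes_span (Set.toFinite _) hm
  have h3 := (three_le_height_vanishingIdeal_zero (K := K)).trans h2
  have h4 : ({A, B} : Set (MvPolynomial (Fin 3) K)).ncard ≤ 2 := by
    simpa using Set.ncard_insert_le A {B}
  have h5 : 3 ≤ ({A, B} : Set (MvPolynomial (Fin 3) K)).ncard := by exact_mod_cast h3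
  omega

end CommonZero

/-! ### Factors of homogeneous polynomials -/

section Homogeneous

/-- The substitution `X i ↦ T X i`, whose coefficients in `T` are the homogeneous components. -/
noncomputable def MvPolynomial.scaleVars {σ R : Type*} [CommRing R] :
    MvPolynomial σ R →ₐ[R] Polynomial (MvPolynomial σ R) :=
  aeval fun i => Polynomial.C (X i) * Polynomial.X

theorem MvPolynomial.scaleVars_of_isHomogeneous {σ R : Type*} [CommRing R]
    {A : MvPolynomial σ R} {n : ℕ} (hA : A.IsHomogeneous n) :
    scaleVars A = Polynomial.C A * Polynomial.X ^ n := by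
  have h : ∀ m ∈ A.support, scaleVars (monomial m (A.coeff m)) =
      Polynomial.C (monomial m (A.coeff m)) * Polynomial.X ^ n := by
    intro m hm
    have hd : m.degree = n := by
      rw [← hA (mem_support_iff.mp hm), Finsupp.degree_eq_weight_one]
      rfl
    have e : ∀ i : σ, (Polynomial.C (X i : MvPolynomial σ R) * Polynomial.X) ^ m i =
        Polynomial.C (X i ^ m i) * Polynomial.X ^ m i := by
      intro i
      rw [mul_pow, map_pow]
    rw [scaleVars, aeval_monomial, Finsupp.prod, Finset.prod_congr rfl fun i _ => e i,
      Finset.prod_mul_distrib, Finset.prod_pow_eq_pow_sum, ← hd, Finsupp.degree, ← map_prod,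
      ← mul_assoc, monomial_eq, map_mul, Finsupp.prod]
    rfl
  have h' : A = ∑ m ∈ A.support, monomial m (A.coeff m) := A.as_sum
  rw [congrArg scaleVars h', map_sum, Finset.sum_congr rfl h, ← Finset.sum_mul, ← map_sum, ← h']

theorem MvPolynomial.coeff_scaleVars {σ R : Type*} [CommRing R] (A : MvPolynomial σ R) (n : ℕ) :
    (scaleVars A).coeff n = homogeneousComponent n A := by
  conv_lhs => rw [← sum_homogeneousComponent A, map_sum, Polynomial.finsetSum_coeff]
  simp only [scaleVars_of_isHomogeneous (homogeneousComponent_isHomogeneous _ A),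
    Polynomial.coeff_C_mul, Polynomial.coeff_X_pow, mul_ite, mul_one, mul_zero]
  rw [Finset.sum_ite_eq]
  split_ifs with h
  · rfl
  · exact (homogeneousComponent_eq_zero n A (by simpa using h)).symm

/-- After the substitution the product is a monomial in T, so its degree and trailing degree agree.
Over a domain both are additive, hence they agree for each factor too. -/
theorem MvPolynomial.IsHomogeneous.of_mul_left {σ R : Type*} [CommRing R] [IsDomain R]
    {A B : MvPolynomial σ R} {n : ℕ}
    (h : (A * B).IsHomogeneous n) (h0 : A * B ≠ 0) : ∃ m, A.IsHomogeneous m := by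
  have hs := scaleVars_of_isHomogeneous h
  have hinj : ∀ P : MvPolynomial σ R, P ≠ 0 → scaleVars P ≠ 0 := by
    intro P hP hz
    apply hP
    rw [← sum_homogeneousComponent P]
    exact Finset.sum_eq_zero fun i _ => by rw [← coeff_scaleVars, hz, Polynomial.coeff_zero]
  have hA := hinj A (left_ne_zero_of_mul h0)
  have hB := hinj B (right_ne_zero_of_mul h0)
  rw [map_mul] at hs
  have hd := congrArg Polynomial.natDegree hs
  have ht := congrArg Polynomial.natTrailingDegree hs
  rw [Polynomial.natDegree_mul hA hB, Polynomial.natDegree_C_mul_X_pow _ _ h0] at hd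
  rw [Polynomial.natTrailingDegree_mul hA hB, Polynomial.C_mul_X_pow_eq_monomial,
    Polynomial.natTrailingDegree_monomial h0] at ht
  have h1 := Polynomial.natTrailingDegree_le_natDegree (scaleVars A)
  have h2 := Polynomial.natTrailingDegree_le_natDegree (scaleVars B)
  generalize hN : (scaleVars A).natDegree = N at *
  refine ⟨N, ?_⟩
  have hAc : homogeneousComponent N A = A := by
    refine Eq.trans ?_ (sum_homogeneousComponent A)
    simp only [← coeff_scaleVars]
    symm
    rw [Finset.sum_eq_single N]
    · intro i _ hi
      rcases lt_or_gt_of_ne hi with h | h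
      · exact Polynomial.coeff_eq_zero_of_lt_natTrailingDegree (by omega)
      · exact Polynomial.coeff_eq_zero_of_natDegree_lt (hN ▸ h)
    · intro h
      rw [coeff_scaleVars]
      exact homogeneousComponent_eq_zero _ A (by simpa using h)
  have hh := homogeneousComponent_isHomogeneous N A
  rwa [hAc] at hh

/-- The cofactor of a homogeneous polynomial in a homogeneous polynomial is homogeneous. -/
theorem MvPolynomial.IsHomogeneous.of_mul_right {σ R : Type*} [CommRing R] [IsDomain R]
    {A B : MvPolynomial σ R} {m n : ℕ} (hA : A.IsHomogeneous m) (hA0 : A ≠ 0)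
    (h : (A * B).IsHomogeneous n) (hmn : m ≤ n) : B.IsHomogeneous (n - m) := by
  rcases eq_or_ne B 0 with rfl | hB
  · exact isHomogeneous_zero _ _ _
  have h0 : A * B ≠ 0 := mul_ne_zero hA0 hB
  obtain ⟨e, he⟩ := IsHomogeneous.of_mul_left (A := B) (B := A) (by rwa [mul_comm])
    (by rwa [mul_comm])
  have hme := (hA.mul he).inj_right h h0
  have : e = n - m := by omega
  rwa [← this]

end Homogeneous

/-! ### Gradients, smooth forms and irreducibility -/

section Forms

variable {K : Type*} [Field K]

theorem MvPolynomial.IsHomogeneous.eval_smul {σ : Type*} {F : MvPolynomial σ K} {n : ℕ}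
    (hF : F.IsHomogeneous n) (c : K) (v : σ → K) : eval (c • v) F = c ^ n * eval v F := by
  have h := congrArg (Polynomial.eval c ∘ Polynomial.map (eval v)) (scaleVars_of_isHomogeneous hF)
  have e : ∀ G : MvPolynomial σ K,
      Polynomial.eval c (Polynomial.map (eval v) (scaleVars G)) = eval (c • v) G := by
    intro G
    induction G using MvPolynomial.induction_on with
    | C a => simp [scaleVars, algebraMap_eq, IsScalarTower.algebraMap_apply K (MvPolynomial σ K)]
    | add p q hp hq => simp_all
    | mul_X p i hp =>
      rw [map_mul, Polynomial.map_mul, Polynomial.eval_mul, hp]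
      simp [scaleVars, mul_comm c]
  simp only [Function.comp_apply, e] at h
  rw [h, Polynomial.map_mul, Polynomial.eval_mul]
  simp [mul_comm (c ^ n)]

theorem MvPolynomial.IsHomogeneous.eval_zero_eq_zero {σ : Type*} {F : MvPolynomial σ K} {n : ℕ}
    (hF : F.IsHomogeneous n) (hn : n ≠ 0) : eval 0 F = 0 := by
  have := hF.eval_smul 0 0
  rwa [smul_zero, zero_pow hn, zero_mul] at this

/-- The gradient of `F` at `v`. -/
noncomputable def MvPolynomial.grad (F : MvPolynomial (Fin 3) K) (v : Fin 3 → K) : Fin 3 → K :=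
  fun i => eval v (pderiv i F)

theorem MvPolynomial.grad_mul (A B : MvPolynomial (Fin 3) K) (v : Fin 3 → K) :
    grad (A * B) v = eval v A • grad B v + eval v B • grad A v := by
  ext i
  simp [grad]

theorem MvPolynomial.IsHomogeneous.dotProduct_grad {F : MvPolynomial (Fin 3) K} {d : ℕ}
    (hF : F.IsHomogeneous d) (v : Fin 3 → K) : grad F v ⬝ᵥ v = d * eval v F := by
  have := congrArg (eval v) hF.sum_X_mul_pderiv
  simp only [map_sum, map_mul, eval_X, nsmul_eq_mul, map_natCast] at this
  rw [← this]
  exact Finset.sum_congr rfl fun i _ => mul_comm _ _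

theorem MvPolynomial.IsHomogeneous.grad_smul {F : MvPolynomial (Fin 3) K} {d : ℕ}
    (hF : F.IsHomogeneous d) (c : K) (v : Fin 3 → K) :
    grad F (c • v) = c ^ (d - 1) • grad F v := by
  ext i
  simp [grad, hF.pderiv.eval_smul]

/-- The projective plane curve with equation `F` is smooth. -/
def MvPolynomial.IsSmoothForm (F : MvPolynomial (Fin 3) K) : Prop :=
  ∀ v, v ≠ 0 → eval v F = 0 → grad F v ≠ 0

/-- Two nonconstant factors of F are homogeneous, so both vanish at the origin and hence at some
nonzero point. By the product rule this point is singular. -/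
theorem MvPolynomial.IsSmoothForm.irreducible [IsAlgClosed K] {F : MvPolynomial (Fin 3) K} {d : ℕ}
    (hs : F.IsSmoothForm) (hF : F.IsHomogeneous d) (hd : d ≠ 0) (h0 : F ≠ 0) : Irreducible F := by
  have key : ∀ A B : MvPolynomial (Fin 3) K, F = A * B → ¬ IsUnit A → eval 0 A = 0 := by
    intro A B h hA
    rw [h] at hF h0
    obtain ⟨m, hm⟩ := hF.of_mul_left h0
    refine hm.eval_zero_eq_zero ?_
    rintro rfl
    obtain ⟨c, rfl⟩ : ∃ c, A = C c := ⟨_, totalDegree_eq_zero_iff_eq_C.mp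
      (Nat.le_zero.mp hm.totalDegree_le)⟩
    refine hA ((isUnit_iff_ne_zero.mpr ?_).map C)
    rintro rfl
    simp at h0
  refine ⟨fun hu => ?_, fun A B h => ?_⟩
  · have := hu.map (eval (0 : Fin 3 → K))
    rw [hF.eval_zero_eq_zero hd] at this
    exact not_isUnit_zero this
  · by_contra! hAB
    obtain ⟨v, hv, hA, hB⟩ := exists_common_zero (key A B h hAB.1)
      (key B A (by rw [h, mul_comm]) hAB.2)
    refine hs v hv (by rw [h, map_mul, hA, zero_mul]) ?_
    rw [h, grad_mul, hA, hB, zero_smul, zero_smul, add_zero]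

theorem MvPolynomial.IsHomogeneous.not_dvd {σ : Type*} {F G : MvPolynomial σ K} {d : ℕ}
    (hF : F.IsHomogeneous d) (hG : G ≠ 0) (h : G.totalDegree < d) : ¬ F ∣ G := by
  rintro ⟨E, rfl⟩
  have hF0 := left_ne_zero_of_mul hG
  rw [totalDegree_mul_of_isDomain hF0 (right_ne_zero_of_mul hG), hF.totalDegree hF0] at h
  omega

/-- A polynomial vanishing on an irreducible plane curve is a multiple of its equation. -/
theorem MvPolynomial.dvd_of_forall_eval_eq_zero [IsAlgClosed K] {F G : MvPolynomial (Fin 3) K}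
    {d : ℕ} (hF : F.IsHomogeneous d) (hd : 1 < d) (hi : Irreducible F)
    (h : ∀ v, v ≠ 0 → eval v F = 0 → eval v G = 0) : F ∣ G := by
  -- The hypothesis says nothing about the origin; the factor `X 0` makes the product vanish there,
  -- and is harmless because F has degree greater than 1.
  have hm : G * X 0 ∈ vanishingIdeal K (zeroLocus K (Ideal.span {F})) := by
    intro v hv
    rw [zeroLocus_span] at hv
    have hv : eval v F = 0 := hv F rfl
    show eval v (G * X 0) = 0
    rcases eq_or_ne v 0 with rfl | h0
    · simp
    · rw [map_mul, h v h0 hv, zero_mul]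
  rw [vanishingIdeal_zeroLocus_eq_radical] at hm
  obtain ⟨n, hn⟩ := hm
  rw [Ideal.mem_span_singleton] at hn
  refine (hi.prime.dvd_or_dvd (hi.prime.dvd_of_dvd_pow hn)).resolve_right ?_
  exact hF.not_dvd (X_ne_zero _) (by simpa using hd)

end Forms

/-! ### Linear algebra in three-space and homogeneous coordinates -/

section Vectors

variable {K : Type*} [Field K]

theorem exists_eq_smul_of_dotProduct {a b : Fin 3 → K} (ha : a ≠ 0)
    (h : ∀ v, a ⬝ᵥ v = 0 → b ⬝ᵥ v = 0) : ∃ c : K, b = c • a := by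
  obtain ⟨i, hi⟩ := Function.ne_iff.mp ha
  refine ⟨b i / a i, ?_⟩
  ext j
  have := h (a i • Pi.single j 1 - a j • Pi.single i 1) (by simp; ring)
  simp at this
  have hi' : a i ≠ 0 := hi
  simp
  field_simp
  linear_combination this

theorem exists_eq_smul_of_crossProduct_eq_zero {a b : Fin 3 → K} (ha : a ≠ 0)
    (h : crossProduct a b = 0) : ∃ t : K, b = t • a := by
  have h0 := congrFun h 0
  have h1 := congrFun h 1
  have h2 := congrFun h 2
  simp [cross_apply] at h0 h1 h2
  obtain ⟨i, hi⟩ := Function.ne_iff.mp ha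
  have hi : a i ≠ 0 := hi
  refine ⟨b i / a i, ?_⟩
  ext j
  simp
  field_simp
  fin_cases i <;> fin_cases j <;> simp <;> grind

/-- In the plane orthogonal to `a`, the kernel of a nonzero functional is a line. -/
theorem exists_eq_smul_of_orthogonal {a b c w m : Fin 3 → K} (hb0 : b ≠ 0)
    (hb : a ⬝ᵥ b = 0) (hc : a ⬝ᵥ c = 0) (hw : a ⬝ᵥ w = 0) (ha : a ≠ 0)
    (hmb : m ⬝ᵥ b = 0) (hmc : m ⬝ᵥ c ≠ 0) (hmw : m ⬝ᵥ w = 0) : ∃ t : K, w = t • b := by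
  rcases Configuration.ofField.crossProduct_eq_zero_of_dotProduct_eq_zero hb hmb hw hmw with h | h
  · obtain ⟨t, rfl⟩ := exists_eq_smul_of_crossProduct_eq_zero ha h
    rw [smul_dotProduct, hc, smul_zero] at hmc
    exact absurd rfl hmc
  · exact exists_eq_smul_of_crossProduct_eq_zero hb0 h

theorem Plane.exists_rep_mk (v : Fin 3 → K) (hv : v ≠ 0) :
    ∃ c : K, c ≠ 0 ∧ (Projectivization.mk K v hv).rep = c • v := by
  obtain ⟨a, ha⟩ := Projectivization.exists_smul_eq_mk_rep K v hv
  exact ⟨a, a.ne_zero, ha.symm⟩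

theorem Plane.eval_rep_mk {G : MvPolynomial (Fin 3) K} {n : ℕ} (hG : G.IsHomogeneous n)
    (v : Fin 3 → K) (hv : v ≠ 0) :
    eval (Projectivization.mk K v hv).rep G = 0 ↔ eval v G = 0 := by
  obtain ⟨c, hc, h⟩ := Plane.exists_rep_mk v hv
  rw [h, hG.eval_smul]
  simp [hc]

theorem Plane.eq_of_rep_eq_smul {P Q : Plane K} {c : K} (h : P.rep = c • Q.rep) : P = Q := by
  rw [← P.mk_rep, ← Q.mk_rep, Projectivization.mk_eq_mk_iff']
  exact ⟨c, h.symm⟩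

end Vectors

/-! ### Equations of the dual curve -/

section DualForm

variable {K : Type*} [Field K]

instance MvPolynomial.finite_homogeneousSubmodule {σ : Type*} [Finite σ] (n : ℕ) :
    Module.Finite K (homogeneousSubmodule σ K n) :=
  Module.Finite.iff_fg.mpr (homogeneousSubmodule_fg σ K n)

theorem MvPolynomial.two_mul_finrank_homogeneousSubmodule (n : ℕ) :
    2 * Module.finrank K (homogeneousSubmodule (Fin 3) K n) = (n + 1) * (n + 2) := by
  have h : Module.finrank K (homogeneousSubmodule (Fin 3) K n) = (n + 2).choose n := by
    rw [homogeneousSubmodule_eq_finsupp_supported]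
    change Module.finrank K (restrictSupport K {d : Fin 3 →₀ ℕ | d.degree = n}) = _
    rw [Module.finrank_eq_nat_card_basis (basisRestrictSupport K _)]
    have e : {d : Fin 3 →₀ ℕ | d.degree = n} =
        ((Finset.univ : Finset (Fin 3)).finsuppAntidiag n : Set (Fin 3 →₀ ℕ)) := by
      ext f
      simp [Finsupp.degree_eq_sum]
    rw [e, Nat.card_coe_set_eq, Set.ncard_coe_finset, Finset.card_finsuppAntidiag_nat_eq_choose]
    simp only [Finset.card_univ, Fintype.card_fin]
    congr 1
    omega
  rw [h, Nat.choose_symm_add, Nat.choose_two_right]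
  have := Nat.even_mul_pred_self (n + 2)
  rw [Nat.mul_div_cancel' this.two_dvd]
  simp; ring

/-- Vanishing partials force every exponent to be divisible by p; perfectness supplies p-th roots of
the coefficients, and Frobenius is additive. -/
theorem MvPolynomial.exists_pow_eq_of_pderiv_eq_zero {σ : Type*} {p : ℕ} [Fact p.Prime] [CharP K p]
    [PerfectRing K p] {G : MvPolynomial σ K} (h : ∀ i, pderiv i G = 0) : ∃ H, H ^ p = G := by
  have hdvd : ∀ m ∈ G.support, ∀ i, p ∣ m i := by
    intro m hm i
    by_contra hp
    have hmi : m i ≠ 0 := fun h0 => hp (h0 ▸ dvd_zero p)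
    have := congrArg (coeff (m - Finsupp.single i 1)) (h i)
    have hle : Finsupp.single i 1 ≤ m := by
      rw [Finsupp.single_le_iff]
      omega
    rw [coeff_pderiv, tsub_add_cancel_of_le hle, coeff_zero, mul_eq_zero,
      or_iff_right (mem_support_iff.mp hm)] at this
    apply hp
    rw [← CharP.cast_eq_zero_iff K p, ← this]
    simp only [Finsupp.tsub_apply, Finsupp.single_eq_same]
    rw [← Nat.cast_add_one, Nat.sub_add_cancel (by omega)]
  have hex : ∀ m ∈ G.support, ∃ H, H ^ p = monomial m (G.coeff m) := by
    intro m hm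
    choose q hq using fun i => hdvd m hm i
    obtain ⟨c, hc⟩ := (frobeniusEquiv K p).surjective (G.coeff m)
    have hqs : (Function.support q).Finite := m.hasFiniteSupport.subset fun i hi => by
      rw [Function.mem_support, hq]
      exact mul_ne_zero (Fact.out : p.Prime).ne_zero hi
    refine ⟨monomial (Finsupp.ofSupportFinite q hqs) c, ?_⟩
    have hm' : p • Finsupp.ofSupportFinite q hqs = m := by
      ext i
      rw [Finsupp.smul_apply, hq, smul_eq_mul]
      rfl
    rw [monomial_pow, hm', ← hc, frobeniusEquiv_apply, frobenius_def]
  choose! H hH using hex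
  refine ⟨∑ m ∈ G.support, H m, ?_⟩
  rw [sum_pow_char p, Finset.sum_congr rfl hH]
  exact G.as_sum.symm

/-- The substitution `G ↦ G(∂F/∂x₀, ∂F/∂x₁, ∂F/∂x₂)`. -/
noncomputable def MvPolynomial.gradSubst (F : MvPolynomial (Fin 3) K) :
    MvPolynomial (Fin 3) K →ₐ[K] MvPolynomial (Fin 3) K :=
  aeval fun i => pderiv i F

theorem MvPolynomial.eval_gradSubst (F G : MvPolynomial (Fin 3) K) (v : Fin 3 → K) :
    eval v (gradSubst F G) = eval (grad F v) G := by
  induction G using MvPolynomial.induction_on with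
  | C a => simp [gradSubst, algebraMap_eq]
  | add p q hp hq => simp_all
  | mul_X p i hp => simp_all [gradSubst, grad]

theorem MvPolynomial.IsHomogeneous.gradSubst {F G : MvPolynomial (Fin 3) K} {d n : ℕ}
    (hF : F.IsHomogeneous d) (hG : G.IsHomogeneous n) :
    (gradSubst F G).IsHomogeneous ((d - 1) * n) :=
  hG.aeval _ fun _ => hF.pderiv

/-- A dimension count replaces elimination theory: G ↦ G(∇F) maps forms of degree n to forms of
degree (d-1)n, where the multiples of F have codimension only linear in n. -/
theorem MvPolynomial.exists_dvd_gradSubst {F : MvPolynomial (Fin 3) K} {d : ℕ}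
    (hF : F.IsHomogeneous d) (hd : 1 < d) (h0 : F ≠ 0) :
    ∃ n G, G ≠ 0 ∧ G.IsHomogeneous n ∧ F ∣ gradSubst F G := by
  obtain ⟨e, rfl⟩ : ∃ e, d = e + 1 := ⟨d - 1, by omega⟩
  -- That codimension is about d(d-1)n, against roughly n²/2 forms of degree n; n = 2d² is large
  -- enough.
  set n := 2 * (e + 1) ^ 2 with hn
  have hne : e + 1 ≤ e * n := by nlinarith
  obtain ⟨l, hl⟩ := Nat.exists_eq_add_of_le hne
  let V := homogeneousSubmodule (Fin 3) K n
  let W := homogeneousSubmodule (Fin 3) K l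
  let U := homogeneousSubmodule (Fin 3) K (e * n)
  let T₁ : V →ₗ[K] U := ((gradSubst F).toLinearMap.domRestrict V).codRestrict U fun x =>
    hF.gradSubst x.2
  let T₂ : W →ₗ[K] U := ((LinearMap.mulLeft K F).domRestrict W).codRestrict U fun x => by
    have := hF.mul x.2
    rwa [← hl] at this
  have hdim : Module.finrank K U < Module.finrank K (V × W) := by
    rw [Module.finrank_prod]
    have h1 := two_mul_finrank_homogeneousSubmodule (K := K) n
    have h2 := two_mul_finrank_homogeneousSubmodule (K := K) l
    have h3 := two_mul_finrank_homogeneousSubmodule (K := K) (e * n)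
    change 2 * Module.finrank K V = _ at h1
    change 2 * Module.finrank K W = _ at h2
    change 2 * Module.finrank K U = _ at h3
    have : (e * n + 1) * (e * n + 2) < (n + 1) * (n + 2) + (l + 1) * (l + 2) := by
      zify at hl hn ⊢
      have hl' : (l : ℤ) = e * n - (e + 1) := by linarith
      rw [hl']
      nlinarith
    omega
  obtain ⟨⟨G, B⟩, hGB, hne⟩ : ∃ x ∈ LinearMap.ker (T₁.coprod (-T₂)), x ≠ 0 := by
    apply Submodule.exists_mem_ne_zero_of_ne_bot
    exact LinearMap.ker_ne_bot_of_finrank_lt hdim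
  have heq : gradSubst F G = F * B := by
    have : T₁ G + (-T₂) B = 0 := hGB
    have := congrArg Subtype.val this
    simp only [LinearMap.neg_apply, Submodule.coe_add, Submodule.coe_neg] at this
    exact add_neg_eq_zero.mp this
  refine ⟨n, G, fun h => hne ?_, G.2, B, heq⟩
  rw [h, map_zero, eq_comm, mul_eq_zero, or_iff_right h0] at heq
  ext : 2
  · exact h
  · exact heq

/-- Take G of least degree. If F divided all the substituted partials, minimality would make the
partials zero, so G = H^p; then F divides H(∇F) by primality, and H has smaller degree. -/
theorem MvPolynomial.exists_dvd_gradSubst_not_dvd_pderiv {p : ℕ} [Fact p.Prime] [CharP K p]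
    [PerfectRing K p] {F : MvPolynomial (Fin 3) K} {d : ℕ}
    (hF : F.IsHomogeneous d) (hd : 1 < d) (hi : Irreducible F) :
    ∃ n G i, G.IsHomogeneous n ∧ F ∣ gradSubst F G ∧ ¬ F ∣ gradSubst F (pderiv i G) := by
  classical
  have hex := exists_dvd_gradSubst hF hd hi.ne_zero
  obtain ⟨G, hG0, hG, hFG⟩ := Nat.find_spec hex
  have hmin := fun m => @Nat.find_min _ _ hex m
  generalize Nat.find hex = n at *
  have hn : n ≠ 0 := by
    rintro rfl
    obtain ⟨c, rfl⟩ : ∃ c, G = C c := ⟨_, totalDegree_eq_zero_iff_eq_C.mp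
      (Nat.le_zero.mp hG.totalDegree_le)⟩
    refine hF.not_dvd ?_ ?_ hFG
    · simpa [gradSubst, algebraMap_eq] using hG0
    · simp [gradSubst, algebraMap_eq]; omega
  by_contra! hall
  have hz : ∀ i, pderiv i G = 0 := by
    intro i
    by_contra hne
    exact hmin (n - 1) (by omega) ⟨_, hne, hG.pderiv, hall n G i hG hFG⟩
  obtain ⟨H, rfl⟩ := exists_pow_eq_of_pderiv_eq_zero hz
  have hp := (Fact.out : p.Prime)
  obtain ⟨q, rfl⟩ : ∃ q, p = q + 1 := ⟨p - 1, by have := hp.pos; omega⟩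
  obtain ⟨m, hm⟩ : ∃ m, H.IsHomogeneous m := by
    rw [pow_succ'] at hG hG0
    exact hG.of_mul_left hG0
  have hmn : m * (q + 1) = n := (hm.pow (q + 1)).inj_right hG hG0
  refine hmin m ?_ ⟨H, fun h => hG0 (by simp [h]), hm, ?_⟩
  · have := hp.two_le
    have : m ≠ 0 := by rintro rfl; omega
    rw [← hmn]
    nlinarith [Nat.pos_of_ne_zero this]
  · rw [map_pow] at hFG
    exact hi.prime.dvd_of_dvd_pow hFG

end DualForm

/-! ### The Hessian form and the differential of the Gauss map -/

section Hessian

variable {K : Type*} [Field K]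

theorem MvPolynomial.pderiv_pderiv_comm {σ R : Type*} [CommRing R] (i j : σ)
    (F : MvPolynomial σ R) : pderiv i (pderiv j F) = pderiv j (pderiv i F) := by
  classical
  have h : ⁅(pderiv i : Derivation R (MvPolynomial σ R) (MvPolynomial σ R)), pderiv (R := R) j⁆ = 0 := by
    refine derivation_ext (R := R) fun l => ?_
    rw [Derivation.commutator_apply, pderiv_X, pderiv_X, Derivation.zero_apply]
    by_cases h1 : l = j <;> by_cases h2 : l = i <;> simp [Pi.single_apply, h1, h2]
    all_goals split_ifs <;> simp
  have := Derivation.commutator_apply (D1 := pderiv (R := R) i) (D2 := pderiv (R := R) j) F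
  rw [h, Derivation.zero_apply] at this
  exact sub_eq_zero.mp this.symm

/-- The Hessian matrix of `F` at `v`. -/
noncomputable def MvPolynomial.hess (F : MvPolynomial (Fin 3) K) (v : Fin 3 → K) :
    Matrix (Fin 3) (Fin 3) K :=
  Matrix.of fun i j => eval v (pderiv j (pderiv i F))

theorem MvPolynomial.hess_transpose (F : MvPolynomial (Fin 3) K) (v : Fin 3 → K) :
    (hess F v).transpose = hess F v := by
  ext i j
  simp only [hess, Matrix.transpose_apply, Matrix.of_apply]
  rw [pderiv_pderiv_comm]

theorem MvPolynomial.dotProduct_hess_mulVec_comm (F : MvPolynomial (Fin 3) K) (v a b : Fin 3 → K) :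
    a ⬝ᵥ (hess F v).mulVec b = b ⬝ᵥ (hess F v).mulVec a := by
  rw [Matrix.dotProduct_mulVec, ← Matrix.mulVec_transpose, hess_transpose, dotProduct_comm]

theorem MvPolynomial.IsHomogeneous.hess_mulVec_self {F : MvPolynomial (Fin 3) K} {d : ℕ}
    (hF : F.IsHomogeneous d) (v : Fin 3 → K) :
    (hess F v).mulVec v = ((d - 1 : ℕ) : K) • grad F v := by
  ext i
  exact (hF.pderiv (i := i)).dotProduct_grad v

/-- Makes each tangent direction the value of a polynomial vector field ∇F × a, so that pointwise
statements about it become divisibility by F. -/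
theorem exists_eq_crossProduct {g q : Fin 3 → K} (hg : g ≠ 0) (h : g ⬝ᵥ q = 0) :
    ∃ a, q = crossProduct g a := by
  obtain ⟨i, hi⟩ := Function.ne_iff.mp hg
  have hi : g i ≠ 0 := hi
  simp [Fin.sum_univ_three, dotProduct] at h
  fin_cases i
  · refine ⟨![0, q 2 / g 0, - q 1 / g 0], ?_⟩
    simp at hi
    ext j
    fin_cases j <;> simp [cross_apply] <;> field_simp <;> grind
  · refine ⟨![- q 2 / g 1, 0, q 0 / g 1], ?_⟩
    simp at hi
    ext j
    fin_cases j <;> simp [cross_apply] <;> field_simp <;> grind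
  · refine ⟨![q 1 / g 2, - q 0 / g 2, 0], ?_⟩
    simp at hi
    ext j
    fin_cases j <;> simp [cross_apply] <;> field_simp <;> grind

/-- The second fundamental form of the plane curve `F = 0` vanishes identically: the Hessian form
vanishes on every tangent line. -/
def MvPolynomial.IsFlat (F : MvPolynomial (Fin 3) K) : Prop :=
  ∀ v q, v ≠ 0 → eval v F = 0 → grad F v ⬝ᵥ q = 0 → q ⬝ᵥ (hess F v).mulVec q = 0

/-- The vector field `∇F × a`, tangent to the curve `F = 0`. -/
noncomputable def MvPolynomial.tangentField (F : MvPolynomial (Fin 3) K) (a : Fin 3 → K) :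
    Fin 3 → MvPolynomial (Fin 3) K :=
  crossProduct (fun i => pderiv i F) (fun i => C (a i))

theorem MvPolynomial.eval_tangentField (F : MvPolynomial (Fin 3) K) (a v : Fin 3 → K) (i : Fin 3) :
    eval v (tangentField F a i) = crossProduct (grad F v) a i := by
  fin_cases i <;> simp [tangentField, cross_apply, grad]

/-- The value of the Hessian form on two tangent vector fields. -/
noncomputable def MvPolynomial.secondForm (F : MvPolynomial (Fin 3) K) (a b : Fin 3 → K) :
    MvPolynomial (Fin 3) K :=
  ∑ i, ∑ j, tangentField F a i * pderiv j (pderiv i F) * tangentField F b j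

theorem MvPolynomial.eval_secondForm (F : MvPolynomial (Fin 3) K) (a b v : Fin 3 → K) :
    eval v (secondForm F a b) = crossProduct (grad F v) a ⬝ᵥ
      (hess F v).mulVec (crossProduct (grad F v) b) := by
  simp only [secondForm, map_sum, map_mul, eval_tangentField, dotProduct, Matrix.mulVec, hess,
    Matrix.of_apply, Finset.mul_sum, mul_assoc]

/-- Differentiate G(∇F) = F·E by the chain rule; on the curve the term with the derivative of E
drops out. -/
theorem MvPolynomial.sum_grad_mul_hess {F G E : MvPolynomial (Fin 3) K}
    (h : gradSubst F G = F * E) {v : Fin 3 → K} (hv : eval v F = 0) (q : Fin 3 → K) :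
    grad G (grad F v) ⬝ᵥ (hess F v).mulVec q = eval v E * (grad F v ⬝ᵥ q) := by
  have key : ∀ j, ∑ i, grad G (grad F v) i * hess F v i j = eval v E * grad F v j := by
    intro j
    have h1 := derivation_aeval (pderiv j) (fun i => pderiv i F) G
    have h2 := congrArg (eval v) (h1.symm.trans (congrArg (pderiv j) h))
    rw [pderiv_mul, map_add, map_mul, map_mul, hv, zero_mul, add_zero, map_sum] at h2
    rw [mul_comm (eval v E)]
    refine Eq.trans (Finset.sum_congr rfl fun i _ => ?_) h2
    rw [map_mul]
    congr 1
    exact (eval_gradSubst F (pderiv i G) v).symm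
  rw [Matrix.dotProduct_mulVec]
  simp only [dotProduct, Matrix.vecMul, key, Finset.mul_sum, mul_assoc]

theorem MvPolynomial.exists_grad_grad_eq_smul [IsAlgClosed K] {F : MvPolynomial (Fin 3) K} {d : ℕ}
    (hF : F.IsHomogeneous d) (hd : 1 < d) (hd1 : (d : K) = 1) (hi : Irreducible F)
    (hs : F.IsSmoothForm) (hnf : ¬ F.IsFlat) {G : MvPolynomial (Fin 3) K} {n : ℕ}
    (hG : G.IsHomogeneous n) (hFG : F ∣ gradSubst F G) {v : Fin 3 → K} (hv0 : v ≠ 0)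
    (hv : eval v F = 0) : ∃ t : K, grad G (grad F v) = t • v := by
  have hd0 : ((d - 1 : ℕ) : K) = 0 := by rw [Nat.cast_sub hd.le, hd1]; simp
  obtain ⟨E, hE⟩ := hFG
  have hpt : ∀ u q, u ≠ 0 → eval u F = 0 → grad F u ⬝ᵥ q = 0 → q ⬝ᵥ (hess F u).mulVec q ≠ 0 →
      ∃ t : K, grad G (grad F u) = t • u := by
    intro u q hu0 hu hq hqq
    refine exists_eq_smul_of_orthogonal (a := grad F u) (c := q) (m := (hess F u).mulVec q)
      hu0 ?_ hq ?_ (hs u hu0 hu) ?_ ?_ ?_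
    · rw [hF.dotProduct_grad, hu, mul_zero]
    · rw [dotProduct_comm, hG.dotProduct_grad, ← eval_gradSubst, hE, map_mul, hu, zero_mul,
        mul_zero]
    · rw [dotProduct_comm, dotProduct_hess_mulVec_comm, hF.hess_mulVec_self, hd0, zero_smul,
        dotProduct_zero]
    · rwa [dotProduct_comm]
    · rw [dotProduct_comm, sum_grad_mul_hess hE hu, hq, mul_zero]
  unfold IsFlat at hnf
  push Not at hnf
  obtain ⟨u, q, hu0, hu, hq, hqq⟩ := hnf
  obtain ⟨a, rfl⟩ := exists_eq_crossProduct (hs u hu0 hu) hq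
  have hndvd : ¬ F ∣ secondForm F a a := by
    rintro ⟨B, hB⟩
    rw [← eval_secondForm, hB, map_mul, hu, zero_mul] at hqq
    exact hqq rfl
  -- Proportionality is known so far only where the second form is nonzero. Multiplying the 2×2
  -- minors by `secondForm F a a` gives multiples of F, and primality cancels this factor, which F
  -- does not divide.
  have hpar : ∀ i j, F ∣ gradSubst F (pderiv i G) * X j - gradSubst F (pderiv j G) * X i := by
    intro i j
    refine (hi.prime.dvd_or_dvd (dvd_of_forall_eval_eq_zero hF hd hi
      (G := secondForm F a a * _) fun x hx0 hx => ?_)).resolve_left hndvd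
    rw [map_mul, mul_eq_zero, or_iff_not_imp_left, eval_secondForm]
    intro h
    obtain ⟨t, ht⟩ := hpt x _ hx0 hx (dot_self_cross _ _) h
    have e : ∀ i, eval x (gradSubst F (pderiv i G)) = t * x i := fun i =>
      (eval_gradSubst F (pderiv i G) x).trans (congrFun ht i)
    rw [map_sub, map_mul, map_mul, e, e, eval_X, eval_X]
    ring
  obtain ⟨i, hi0⟩ := Function.ne_iff.mp hv0
  have hi0 : v i ≠ 0 := hi0
  refine ⟨grad G (grad F v) i / v i, ?_⟩
  ext j
  obtain ⟨B, hB⟩ := hpar i j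
  have := congrArg (eval v) hB
  rw [map_mul, hv, zero_mul, map_sub, map_mul, map_mul, eval_gradSubst, eval_gradSubst, eval_X,
    eval_X] at this
  change grad G (grad F v) i * v j - grad G (grad F v) j * v i = 0 at this
  rw [Pi.smul_apply, smul_eq_mul]
  field_simp
  linear_combination -this

end Hessian

/-! ### Gauss maps in coordinates, and reflexivity of non-flat curves -/

namespace Plane

variable {K : Type*} [Field K]

/-- The set of points of the plane curve with equation `F`. -/
def zeros (F : MvPolynomial (Fin 3) K) : Set (Plane K) := {P | eval P.rep F = 0}

theorem eval_rep_eq_zero {F G : MvPolynomial (Fin 3) K} (h : F ∣ G) {P : Plane K}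
    (hP : P ∈ zeros F) : eval P.rep G = 0 := by
  obtain ⟨E, rfl⟩ := h
  rw [map_mul, show eval P.rep F = 0 from hP, zero_mul]

theorem vanishesOn_zariskiClosure {X : Set (Plane K)} {G : MvPolynomial (Fin 3) K} {n : ℕ}
    (hG : G.IsHomogeneous n) : VanishesOn G (zariskiClosure X) ↔ VanishesOn G X :=
  ⟨fun h P hP => h P fun _ _ _ hH => hH P hP, fun h _ hP => hP n G hG h⟩

theorem exists_grad_rep_eq_smul {X : Set (Plane K)} {ℓ Q : Plane K} (h : IsGaussImage X ℓ Q)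
    {G : MvPolynomial (Fin 3) K} {n : ℕ} (hG : G.IsHomogeneous n) (hX : VanishesOn G X) :
    ∃ c : K, grad G ℓ.rep = c • Q.rep :=
  exists_eq_smul_of_dotProduct Q.rep_nonzero fun v hv => (h.2 v).mpr hv n G hG hX

theorem exists_grad_rep_ne_zero {X : Set (Plane K)} {ℓ Q : Plane K} (h : IsGaussImage X ℓ Q) :
    ∃ n G, G.IsHomogeneous n ∧ VanishesOn G X ∧ grad G ℓ.rep ≠ 0 := by
  by_contra! hall
  refine Q.rep_nonzero (dotProduct_eq_zero _ fun v => (h.2 v).mp fun n G hG hX => ?_)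
  change grad G ℓ.rep ⬝ᵥ v = 0
  rw [hall n G hG hX, zero_dotProduct]

variable [IsAlgClosed K] {F : MvPolynomial (Fin 3) K} {d : ℕ}

theorem vanishesOn_zeros (hF : F.IsHomogeneous d) (hd : 1 < d) (hi : Irreducible F)
    {G : MvPolynomial (Fin 3) K} {n : ℕ} (hG : G.IsHomogeneous n) :
    VanishesOn G (zeros F) ↔ F ∣ G := by
  refine ⟨fun h => dvd_of_forall_eval_eq_zero hF hd hi fun v hv0 hv => ?_,
    fun h _ hP => eval_rep_eq_zero h hP⟩
  exact (eval_rep_mk hG v hv0).mp (h _ ((eval_rep_mk hF v hv0).mpr hv))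

theorem mem_tangentSpace_zeros (hF : F.IsHomogeneous d) (hd : 1 < d) (hi : Irreducible F)
    {P : Plane K} (hP : P ∈ zeros F) (v : Fin 3 → K) :
    v ∈ tangentSpace (zeros F) P ↔ grad F P.rep ⬝ᵥ v = 0 := by
  refine ⟨fun h => h d F hF fun Q hQ => hQ, fun h n G hG hX => ?_⟩
  obtain ⟨E, rfl⟩ := (vanishesOn_zeros hF hd hi hG).mp hX
  change grad (F * E) P.rep ⬝ᵥ v = 0
  rw [grad_mul, show eval P.rep F = 0 from hP, zero_smul, zero_add, smul_dotProduct, h, smul_zero]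

theorem isGaussImage_zeros (hF : F.IsHomogeneous d) (hd : 1 < d) (hi : Irreducible F)
    {P ℓ : Plane K} :
    IsGaussImage (zeros F) P ℓ ↔ P ∈ zeros F ∧ ∃ c : K, c ≠ 0 ∧ grad F P.rep = c • ℓ.rep := by
  refine and_congr_right fun hP => ?_
  simp only [mem_tangentSpace_zeros hF hd hi hP]
  constructor
  · intro h
    obtain ⟨c, hc⟩ := exists_eq_smul_of_dotProduct ℓ.rep_nonzero fun v hv => (h v).mpr hv
    refine ⟨c, ?_, hc⟩
    rintro rfl
    apply ℓ.rep_nonzero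
    rw [zero_smul] at hc
    exact dotProduct_eq_zero _ fun v => (h v).mp (by rw [hc, zero_dotProduct])
  · rintro ⟨c, hc, h⟩ v
    rw [h, smul_dotProduct, smul_eq_mul, mul_eq_zero, or_iff_right hc]

theorem vanishesOn_dualCurve_zeros (hF : F.IsHomogeneous d) (hd : 1 < d) (hi : Irreducible F)
    (hs : F.IsSmoothForm) {G : MvPolynomial (Fin 3) K} {n : ℕ} (hG : G.IsHomogeneous n) :
    VanishesOn G (dualCurve (zeros F)) ↔ F ∣ gradSubst F G := by
  rw [dualCurve, vanishesOn_zariskiClosure hG, ← vanishesOn_zeros hF hd hi (hF.gradSubst hG)]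
  constructor
  · intro h P hP
    have h0 := hs _ P.rep_nonzero hP
    obtain ⟨c, hc, hℓ⟩ := exists_rep_mk _ h0
    rw [eval_gradSubst, ← eval_rep_mk hG _ h0]
    refine h _ ⟨P, (isGaussImage_zeros hF hd hi).mpr ⟨hP, c⁻¹, inv_ne_zero hc, ?_⟩⟩
    rw [hℓ, inv_smul_smul₀ hc]
  · rintro h ℓ ⟨P, hP⟩
    obtain ⟨hP, c, hc, e⟩ := (isGaussImage_zeros hF hd hi).mp hP
    have := h P hP
    rw [eval_gradSubst, e, hG.eval_smul, mul_eq_zero] at this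
    exact this.resolve_left (pow_ne_zero n hc)

/-- A smooth plane curve whose Hessian form does not vanish identically along its tangent lines
is reflexive. -/
theorem isReflexive_zeros {p : ℕ} [Fact p.Prime] [CharP K p]
    (hF : F.IsHomogeneous d) (hd : 1 < d) (hd1 : (d : K) = 1) (hi : Irreducible F)
    (hs : F.IsSmoothForm) (hnf : ¬ F.IsFlat) : IsReflexive (zeros F) := by
  have hvan := fun {G : MvPolynomial (Fin 3) K} {n : ℕ} (hG : G.IsHomogeneous n) =>
    vanishesOn_dualCurve_zeros hF hd hi hs hG
  have hgg := fun {G : MvPolynomial (Fin 3) K} {n : ℕ} (hG : G.IsHomogeneous n)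
    (hX : VanishesOn G (dualCurve (zeros F))) {v : Fin 3 → K} (hv0 : v ≠ 0) (hv : eval v F = 0) =>
    exists_grad_grad_eq_smul hF hd hd1 hi hs hnf hG ((hvan hG).mp hX) hv0 hv
  refine ⟨Set.Subset.antisymm ?_ ?_, ?_⟩
  -- F(∇G(∇F)) vanishes on C because ∇G(∇F(v)) is a multiple of v. Hence F(∇G) vanishes on the dual
  -- curve, and at ℓ the gradient of G is a nonzero multiple of Q.
  · have hsub : VanishesOn F {Q | ∃ ℓ, IsGaussImage (dualCurve (zeros F)) ℓ Q} := by
      rintro Q ⟨ℓ, hℓ⟩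
      obtain ⟨n, G, hG, hX, hne⟩ := exists_grad_rep_ne_zero hℓ
      obtain ⟨c, hc⟩ := exists_grad_rep_eq_smul hℓ hG hX
      have hc0 : c ≠ 0 := fun h => hne (by rw [hc, h, zero_smul])
      have hGF : (gradSubst G F).IsHomogeneous ((n - 1) * d) := hG.gradSubst hF
      have hdv : F ∣ gradSubst F (gradSubst G F) := by
        refine dvd_of_forall_eval_eq_zero hF hd hi fun v hv0 hv => ?_
        obtain ⟨t, ht⟩ := hgg hG hX hv0 hv
        rw [eval_gradSubst, eval_gradSubst, ht, hF.eval_smul, hv, mul_zero]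
      have := (hvan hGF).mpr hdv ℓ hℓ.1
      rw [eval_gradSubst, hc, hF.eval_smul, mul_eq_zero] at this
      exact this.resolve_left (pow_ne_zero _ hc0)
    intro P hP
    exact hP d F hF hsub
  -- Where the i-th partial of G at ∇F(v) is nonzero, the dual curve is smooth at ∇F(v) with tangent
  -- line v. Such v are the complement of a proper closed subset of C, which suffices since F is
  -- prime.
  · obtain ⟨n, G, i, hG, hFG, hGi⟩ := exists_dvd_gradSubst_not_dvd_pderiv (p := p) hF hd hi
    have hX := (hvan hG).mpr hFG
    intro P hP m B hB hBX
    refine eval_rep_eq_zero ((hi.prime.dvd_or_dvd (dvd_of_forall_eval_eq_zero hF hd hi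
      (G := gradSubst F (pderiv i G) * B) fun v hv0 hv => ?_)).resolve_left hGi) hP
    rw [map_mul, mul_eq_zero, or_iff_not_imp_left, eval_gradSubst]
    intro hne
    have hg0 := hs v hv0 hv
    obtain ⟨c, hc, hℓ⟩ := exists_rep_mk _ hg0
    rw [← eval_rep_mk hB v hv0]
    refine hBX _ ⟨Projectivization.mk K _ hg0, ?_, fun w => ?_⟩
    · intro l H hH hHX
      rw [eval_rep_mk hH, ← eval_gradSubst]
      have : VanishesOn H (dualCurve (zeros F)) := (vanishesOn_zariskiClosure hH).mpr hHX
      obtain ⟨E, hE⟩ := (hvan hH).mp this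
      rw [hE, map_mul, hv, zero_mul]
    · obtain ⟨b, hb, hv'⟩ := exists_rep_mk v hv0
      rw [hv', smul_dotProduct, smul_eq_mul, mul_eq_zero, or_iff_right hb]
      constructor
      · intro hw
        have h1 : grad G _ ⬝ᵥ w = 0 := hw n G hG hX
        rw [hℓ, hG.grad_smul, smul_dotProduct, smul_eq_mul, mul_eq_zero,
          or_iff_right (pow_ne_zero _ hc)] at h1
        obtain ⟨t, ht⟩ := hgg hG hX hv0 hv
        rw [ht, smul_dotProduct, smul_eq_mul, mul_eq_zero] at h1
        refine h1.resolve_left fun h0 => hne ?_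
        change grad G (grad F v) i = 0
        rw [ht, h0, zero_smul, Pi.zero_apply]
      · intro hw l H hH hHX
        change grad H _ ⬝ᵥ w = 0
        obtain ⟨t, ht⟩ := hgg hH hHX hv0 hv
        rw [hℓ, hH.grad_smul, ht, smul_dotProduct, smul_dotProduct, hw, smul_zero, smul_zero]
  · intro P ℓ Q hP hQ
    obtain ⟨hPF, c, hc, e⟩ := (isGaussImage_zeros hF hd hi).mp hP
    obtain ⟨n, G, hG, hX, hne⟩ := exists_grad_rep_ne_zero hQ
    obtain ⟨b, hb⟩ := exists_grad_rep_eq_smul hQ hG hX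
    obtain ⟨t, ht⟩ := hgg hG hX P.rep_nonzero hPF
    rw [e, hG.grad_smul, hb, smul_smul] at ht
    have hb0 : b ≠ 0 := fun h => hne (by rw [hb, h, zero_smul])
    have hcb : c ^ (n - 1) * b ≠ 0 := mul_ne_zero (pow_ne_zero _ hc) hb0
    refine eq_of_rep_eq_smul (c := (c ^ (n - 1) * b)⁻¹ * t) ?_
    rw [mul_smul, ← ht, inv_smul_smul₀ hcb]

end Plane

/-! ### Contact of order p along the tangent lines of a flat curve -/

section Contact

variable {K : Type*} [Field K]

/-- The restriction of a polynomial to the parametrized line `T ↦ P + T Q`. -/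
noncomputable def MvPolynomial.restrictLine (P Q : Fin 3 → K) :
    MvPolynomial (Fin 3) K →ₐ[K] Polynomial K :=
  aeval fun i => Polynomial.C (P i) + Polynomial.X * Polynomial.C (Q i)

theorem MvPolynomial.eval_restrictLine (P Q : Fin 3 → K) (G : MvPolynomial (Fin 3) K) (t : K) :
    (restrictLine P Q G).eval t = eval (P + t • Q) G := by
  induction G using MvPolynomial.induction_on with
  | C a => simp [restrictLine]
  | add p q hp hq => simp_all
  | mul_X p i hp =>
    rw [map_mul, Polynomial.eval_mul, hp]
    simp [restrictLine, mul_comm t]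

theorem MvPolynomial.derivative_restrictLine (P Q : Fin 3 → K) (G : MvPolynomial (Fin 3) K) :
    Polynomial.derivative (restrictLine P Q G) =
      ∑ i, restrictLine P Q (pderiv i G) * Polynomial.C (Q i) := by
  have := derivation_aeval (K := K) Polynomial.derivative'
    (fun i => Polynomial.C (P i) + Polynomial.X * Polynomial.C (Q i)) G
  refine this.trans (Finset.sum_congr rfl fun i _ => ?_)
  congr 1
  simp [Polynomial.derivative']

/-- Differentiation multiplies the coefficient of X^i by i, which is invertible for 0 < i ≤ k < p.
-/
theorem Polynomial.X_pow_succ_dvd_of_dvd_derivative {p : ℕ} [CharP K p] {f : Polynomial K} {k : ℕ}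
    (hk : k < p) (h0 : f.eval 0 = 0) (h : X ^ k ∣ derivative f) : X ^ (k + 1) ∣ f := by
  rw [X_pow_dvd_iff] at h ⊢
  intro i hi
  cases i with
  | zero => rwa [coeff_zero_eq_eval_zero]
  | succ i =>
    have := h i (by omega)
    rw [coeff_derivative, mul_eq_zero] at this
    refine this.resolve_right fun h => ?_
    rw [← Nat.cast_add_one, CharP.cast_eq_zero_iff K p] at h
    exact absurd (Nat.le_of_dvd (Nat.succ_pos i) h) (by omega)

/-- Polarization: flatness kills the quadratic form, and 2 is invertible. -/
theorem MvPolynomial.IsFlat.dvd_secondForm [IsAlgClosed K] {F : MvPolynomial (Fin 3) K} {d : ℕ}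
    (hflat : F.IsFlat) (h2 : (2 : K) ≠ 0) (hF : F.IsHomogeneous d) (hd : 1 < d)
    (hi : Irreducible F) (a b : Fin 3 → K) : F ∣ secondForm F a b := by
  refine dvd_of_forall_eval_eq_zero hF hd hi fun v hv0 hv => ?_
  rw [eval_secondForm]
  have ha := hflat v _ hv0 hv (dot_self_cross (grad F v) a)
  have hb := hflat v _ hv0 hv (dot_self_cross (grad F v) b)
  have hab := hflat v _ hv0 hv (dot_self_cross (grad F v) (a + b))
  rw [map_add, Matrix.mulVec_add, dotProduct_add, add_dotProduct, add_dotProduct, ha, hb,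
    dotProduct_hess_mulVec_comm F v (crossProduct (grad F v) b)] at hab
  refine (mul_eq_zero.mp ?_).resolve_left h2
  linear_combination hab

/-- If the Hessian form of a curve vanishes on its tangent lines in characteristic `p`, then each
tangent line has contact of order at least `p` with the curve, and the direction of the gradient
is constant to that order along it. -/
theorem MvPolynomial.IsFlat.pow_dvd_restrictLine [IsAlgClosed K] {p : ℕ} [CharP K p]
    {F : MvPolynomial (Fin 3) K} {d : ℕ}
    (hflat : F.IsFlat) (h2 : (2 : K) ≠ 0) (hF : F.IsHomogeneous d) (hd : 1 < d)
    (hi : Irreducible F) {P Q : Fin 3 → K} (hP : eval P F = 0)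
    (hQ : grad F P ⬝ᵥ Q = 0) {j : Fin 3} (hj : grad F P j ≠ 0) :
    Polynomial.X ^ p ∣ restrictLine P Q F ∧ ∀ i, Polynomial.X ^ p ∣
      Polynomial.C (grad F P j) * restrictLine P Q (pderiv i F) -
        Polynomial.C (grad F P i) * restrictLine P Q (pderiv j F) := by
  set r := restrictLine P Q with hr
  set g : Fin 3 → Polynomial K := fun i => r (pderiv i F) with hg
  set γ := grad F P with hγ
  have hγ0 : γ ≠ 0 := fun h => hj (by rw [h]; rfl)
  have hg0 : ∀ i, (g i).eval 0 = γ i := by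
    intro i
    rw [hg, hr, eval_restrictLine, zero_smul, add_zero]
    rfl
  obtain ⟨a, rfl⟩ := exists_eq_crossProduct hγ0 hQ
  have hcop : ∀ k, IsCoprime (Polynomial.X ^ k) (g j) := by
    intro k
    refine IsCoprime.pow_left ((Polynomial.irreducible_X).coprime_iff_not_dvd.mpr ?_)
    rwa [Polynomial.X_dvd_iff, Polynomial.coeff_zero_eq_eval_zero, hg0]
  suffices h : ∀ k ≤ p, Polynomial.X ^ k ∣ r F ∧ ∀ i, Polynomial.X ^ k ∣
      Polynomial.C (γ j) * g i - Polynomial.C (γ i) * g j from h p le_rfl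
  intro k
  induction k with
  | zero => simp
  | succ k ih =>
    intro hk
    obtain ⟨⟨z, hz⟩, hw⟩ := ih (by omega)
    choose u hu using hw
    have hγQ : γ 0 * (crossProduct γ a) 0 + γ 1 * (crossProduct γ a) 1 +
        γ 2 * (crossProduct γ a) 2 = 0 := by
      simpa [dotProduct, Fin.sum_univ_three] using hQ
    have hcj : Polynomial.C (γ j) ≠ 0 := by simpa using hj
    have hgd : ∀ i, Polynomial.derivative (g i) =
        ∑ l, r (pderiv l (pderiv i F)) * Polynomial.C ((crossProduct γ a) l) := fun i =>
      derivative_restrictLine _ _ _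
    constructor
    · refine Polynomial.X_pow_succ_dvd_of_dvd_derivative (p := p) (by omega) ?_ ?_
      · rw [hr, eval_restrictLine, zero_smul, add_zero, hP]
      · have hun : IsUnit (Polynomial.C (γ j)) := by simpa using hj
        rw [← hun.dvd_mul_left, hr, derivative_restrictLine]
        refine ⟨∑ i, u i * Polynomial.C ((crossProduct γ a) i), ?_⟩
        have hq := congrArg Polynomial.C hγQ
        simp only [map_add, map_mul, map_zero] at hq
        simp only [Fin.sum_univ_three]
        linear_combination hu 0 * Polynomial.C ((crossProduct γ a) 0) +
          hu 1 * Polynomial.C ((crossProduct γ a) 1) +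
          hu 2 * Polynomial.C ((crossProduct γ a) 2) + g j * hq
    · intro i
      have hS : ∀ b, Polynomial.X ^ k ∣ r (secondForm F a b) := fun b =>
        (Dvd.intro z hz.symm).trans (map_dvd r (hflat.dvd_secondForm h2 hF hd hi a b))
      -- `T` is the tangent field ∇F × a along the line. By the induction hypothesis ∇F keeps its
      -- direction modulo X^k, so `T` is there proportional to the direction Q = γ × a of the line,
      -- and `v`, the Hessian applied to `T`, to the derivative of `g`.
      let T := fun l => (crossProduct g fun i => Polynomial.C (a i)) l
      have hT : ∀ b l, r (tangentField F b l) =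
          (crossProduct g fun i => Polynomial.C (b i)) l := by
        intro b l
        fin_cases l <;> simp [tangentField, cross_apply, hg, hr, restrictLine]
      let v := fun m => ∑ l, T l * r (pderiv m (pderiv l F))
      have hv : Polynomial.X ^ k ∣ v i * g j - v j * g i := by
        -- By the triple product identity, g × (e_i × e_j) = g_j e_i - g_i e_j, so this choice of
        -- field extracts the desired minor.
        have h1 := hS (crossProduct (Pi.single i 1) (Pi.single j 1))
        have h2 : r (secondForm F a (crossProduct (Pi.single i 1) (Pi.single j 1))) =
            ∑ m, v m * (crossProduct g fun l => Polynomial.C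
              ((crossProduct (Pi.single i 1) (Pi.single j (1 : K))) l)) m := by
          rw [secondForm, Finset.sum_comm, map_sum]
          refine Finset.sum_congr rfl fun m _ => ?_
          rw [map_sum, Finset.sum_mul]
          refine Finset.sum_congr rfl fun l _ => ?_
          rw [map_mul, map_mul, hT, hT]
        rw [h2] at h1
        convert h1 using 1
        simp only [Fin.sum_univ_three, cross_apply]
        fin_cases i <;> fin_cases j <;> simp <;> ring
      have hvg : ∀ m, Polynomial.X ^ k ∣
          Polynomial.C (γ j) * v m - g j * Polynomial.derivative (g m) := by
        intro m
        have hTl : ∀ l, Polynomial.X ^ k ∣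
            Polynomial.C (γ j) * T l - g j * Polynomial.C ((crossProduct γ a) l) := by
          intro l
          refine ⟨(crossProduct u fun i => Polynomial.C (a i)) l, ?_⟩
          have h0 := hu 0
          have h1 := hu 1
          have h2 := hu 2
          fin_cases l <;> simp [T, cross_apply] <;> grind
        have : Polynomial.C (γ j) * v m - g j * Polynomial.derivative (g m) =
            ∑ l, (Polynomial.C (γ j) * T l - g j * Polynomial.C ((crossProduct γ a) l)) *
              r (pderiv m (pderiv l F)) := by
          rw [hgd, Finset.mul_sum, Finset.mul_sum, ← Finset.sum_sub_distrib]
          refine Finset.sum_congr rfl fun l _ => ?_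
          rw [pderiv_pderiv_comm l m]
          ring
        rw [this]
        exact Finset.dvd_sum fun l _ => (hTl l).mul_right _
      obtain ⟨x, hx⟩ := hv
      choose y hy using hvg
      have hgg : Polynomial.X ^ k ∣
          g j * Polynomial.derivative (g i) - g i * Polynomial.derivative (g j) := by
        refine (hcop k).dvd_of_dvd_mul_left ⟨Polynomial.C (γ j) * x - y i * g j + y j * g i, ?_⟩
        linear_combination Polynomial.C (γ j) * hx - hy i * g j + hy j * g i
      obtain ⟨s, hs⟩ := hgg
      refine Polynomial.X_pow_succ_dvd_of_dvd_derivative (p := p) (by omega) ?_ ?_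
      · simp [hg0, mul_comm]
      · refine (hcop k).dvd_of_dvd_mul_left ⟨Polynomial.C (γ j) * s +
          Polynomial.derivative (g j) * u i, ?_⟩
        simp only [Polynomial.derivative_sub, Polynomial.derivative_C_mul]
        linear_combination Polynomial.C (γ j) * hs + Polynomial.derivative (g j) * hu i

end Contact

/-! ### A Bézout inequality by linear algebra -/

section Bezout

variable {K : Type*} [Field K]

/-- The a-th term has order exactly a when its scalar is nonzero, so the system of coefficients is
triangular. -/
theorem Polynomial.eq_zero_of_X_pow_dvd_sum {p : ℕ} {c : Fin p → K} {V : Fin p → Polynomial K}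
    (hV : ∀ a, (V a).eval 0 ≠ 0) (h : X ^ p ∣ ∑ a, C (c a) * (X ^ (a : ℕ) * V a)) (a : Fin p) :
    c a = 0 := by
  induction a using WellFoundedLT.induction with
  | ind a ih =>
    have h0 := X_pow_dvd_iff.mp h a a.2
    rw [finsetSum_coeff, Finset.sum_eq_single a] at h0
    · rw [coeff_C_mul, coeff_X_pow_mul', if_pos le_rfl, Nat.sub_self, coeff_zero_eq_eval_zero,
        mul_eq_zero] at h0
      exact h0.resolve_right (hV a)
    · intro b _ hb
      rcases lt_or_gt_of_ne hb with hlt | hgt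
      · rw [ih b hlt, C_0, zero_mul, coeff_zero]
      · rw [coeff_C_mul, coeff_X_pow_mul', if_neg (by simpa using hgt), mul_zero]
    · simp

/-- The linear form with coefficients `u`. -/
noncomputable def MvPolynomial.linearForm (u : Fin 3 → K) : MvPolynomial (Fin 3) K :=
  ∑ i, C (u i) * X i

theorem MvPolynomial.isHomogeneous_linearForm (u : Fin 3 → K) : (linearForm u).IsHomogeneous 1 :=
  IsHomogeneous.sum _ _ _ fun i _ => (isHomogeneous_X K i).C_mul (u i)

theorem MvPolynomial.eval_linearForm (u v : Fin 3 → K) : eval v (linearForm u) = u ⬝ᵥ v := by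
  simp [linearForm, dotProduct]

theorem MvPolynomial.restrictLine_linearForm {u P : Fin 3 → K} (h : u ⬝ᵥ P = 0) (Q : Fin 3 → K) :
    restrictLine P Q (linearForm u) = Polynomial.X * Polynomial.C (u ⬝ᵥ Q) := by
  have := congrArg Polynomial.C h
  simp only [dotProduct, Fin.sum_univ_three, map_add, map_mul, map_zero] at this
  simp only [linearForm, restrictLine, dotProduct, Fin.sum_univ_three, map_add, map_mul, aeval_X,
    aeval_C, Polynomial.algebraMap_eq]
  linear_combination this

theorem exists_dotProduct_eq_zero_ne_zero {P Q : Fin 3 → K} (hP : P ≠ 0) (h : ∀ c : K, Q ≠ c • P) :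
    ∃ u : Fin 3 → K, u ⬝ᵥ P = 0 ∧ u ⬝ᵥ Q ≠ 0 := by
  by_contra! hall
  obtain ⟨c, hc⟩ := exists_eq_smul_of_dotProduct hP fun v hv => by
    rw [dotProduct_comm]
    exact hall v (by rwa [dotProduct_comm])
  exact h c hc

/-- Bézout's inequality for two curves which both have contact of order at least `p` with given
lines at given points. -/
theorem MvPolynomial.mul_card_le_of_pow_dvd_restrictLine {F G : MvPolynomial (Fin 3) K} {d e p : ℕ}
    (hF : F.IsHomogeneous d) (hG : G.IsHomogeneous e) (hi : Irreducible F) (hFG : ¬ F ∣ G)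
    {ι : Type*} [Fintype ι] (P Q : ι → Fin 3 → K) (hP : ∀ i, P i ≠ 0)
    (hQ : ∀ i, ∀ c : K, Q i ≠ c • P i) (hPP : ∀ i j, i ≠ j → ∀ c : K, P j ≠ c • P i)
    (hPF : ∀ i, Polynomial.X ^ p ∣ restrictLine (P i) (Q i) F)
    (hPG : ∀ i, Polynomial.X ^ p ∣ restrictLine (P i) (Q i) G) :
    p * Fintype.card ι ≤ d * e := by
  classical
  choose L hL0 hL1 using fun i j (h : i ≠ j) => exists_dotProduct_eq_zero_ne_zero (hP i) (hPP i j h)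
  choose M hM0 hM1 using fun i => exists_dotProduct_eq_zero_ne_zero (hP i) (hQ i)
  have hN : ∀ i, ∃ u : Fin 3 → K, u ⬝ᵥ P i ≠ 0 := by
    intro i
    by_contra! h
    exact hP i (dotProduct_eq_zero _ fun v => by rw [dotProduct_comm]; exact h v)
  choose N hN using hN
  set m := Fintype.card ι with hm
  set l := p * m with hl
  -- Since l = pm, the degree n is at least p(m-1) + a for all a < p, so the subtraction in the
  -- exponent of the padding form `N` below is not truncated.
  set n := d + e + l with hn
  let A : ι → MvPolynomial (Fin 3) K := fun j => ∏ i : {i // i ≠ j}, linearForm (L i j i.2)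
  -- Restricted to the j-th line, `Φ (j, a)` has order exactly a at `P j`, while the p-th power of
  -- `A i` makes `Φ (i, a)` with i ≠ j vanish there to order p. As F and G also vanish to order p,
  -- these pm forms are independent modulo (F, G).
  let Φ : ι × Fin p → MvPolynomial (Fin 3) K := fun x =>
    A x.1 ^ p * linearForm (M x.1) ^ (x.2 : ℕ) *
      linearForm (N x.1) ^ (n - p * (m - 1) - (x.2 : ℕ))
  have hA : ∀ j, (A j).IsHomogeneous (m - 1) := by
    intro j
    have : (A j).IsHomogeneous (∑ i : {i // i ≠ j}, 1) :=
      IsHomogeneous.prod _ _ _ fun i _ => isHomogeneous_linearForm _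
    simpa [hm, Fintype.card_subtype_compl] using this
  have hΦ : ∀ x, (Φ x).IsHomogeneous n := by
    rintro ⟨j, a⟩
    have h := (((hA j).pow p).mul ((isHomogeneous_linearForm (M j)).pow (a : ℕ))).mul
      ((isHomogeneous_linearForm (N j)).pow (n - p * (m - 1) - (a : ℕ)))
    convert h using 1
    have hm0 : 0 < m := Fintype.card_pos_iff.mpr ⟨j⟩
    obtain ⟨m', hm'⟩ : ∃ m', m = m' + 1 := ⟨m - 1, by omega⟩
    have ha := a.2
    have : l = p * m' + p := by rw [hl, hm']; ring
    rw [hm', Nat.add_sub_cancel, mul_comm m' p]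
    omega
  let W := homogeneousSubmodule (Fin 3) K
  let T : ((ι × Fin p → K) × (W (e + l) × W (d + l))) →ₗ[K] MvPolynomial (Fin 3) K :=
    (Fintype.linearCombination K Φ).coprod
      (((LinearMap.mulLeft K F).domRestrict _).coprod ((LinearMap.mulLeft K G).domRestrict _))
  have hT : ∀ x, T x = ∑ y, x.1 y • Φ y + (F * x.2.1 + G * x.2.2) := fun x => by
    simp [T, Fintype.linearCombination_apply]
  have hrange : LinearMap.range T ≤ W n := by
    rintro _ ⟨x, rfl⟩
    rw [hT]
    refine add_mem (sum_mem fun y _ => Submodule.smul_mem _ _ (hΦ y)) (add_mem ?_ ?_)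
    · have : (F * x.2.1 : MvPolynomial (Fin 3) K).IsHomogeneous (d + (e + l)) := hF.mul x.2.1.2
      rwa [← add_assoc] at this
    · have : (G * x.2.2 : MvPolynomial (Fin 3) K).IsHomogeneous (e + (d + l)) := hG.mul x.2.2.2
      rwa [← add_assoc, add_comm e d] at this
  have hindep : ∀ x, T x = 0 → x.1 = 0 := by
    intro x hx
    ext ⟨j, a⟩
    set r := restrictLine (P j) (Q j) with hr
    have hsum : Polynomial.X ^ p ∣ ∑ i, ∑ a, x.1 (i, a) • r (Φ (i, a)) := by
      have h0 := congrArg r ((hT x).symm.trans hx)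
      rw [map_zero, map_add, map_add, map_mul, map_mul, map_sum, Fintype.sum_prod_type] at h0
      simp only [map_smul] at h0
      rw [eq_neg_of_add_eq_zero_left h0, dvd_neg]
      exact dvd_add ((hPF j).mul_right _) ((hPG j).mul_right _)
    rw [Fintype.sum_eq_add_sum_compl j, dvd_add_left] at hsum
    · let V : Fin p → Polynomial K := fun a => r (A j) ^ p * Polynomial.C (M j ⬝ᵥ Q j) ^ (a : ℕ) *
        r (linearForm (N j)) ^ (n - p * (m - 1) - (a : ℕ))
      refine Polynomial.eq_zero_of_X_pow_dvd_sum (c := fun a => x.1 (j, a)) (V := V) ?_ ?_ a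
      · intro a
        have hz : ∀ H, (r H).eval 0 = eval (P j) H := fun H => by
          rw [hr, eval_restrictLine, zero_smul, add_zero]
        simp only [V, Polynomial.eval_mul, Polynomial.eval_pow, Polynomial.eval_C, hz,
          eval_linearForm]
        refine mul_ne_zero (mul_ne_zero (pow_ne_zero _ ?_) (pow_ne_zero _ (hM1 j)))
          (pow_ne_zero _ (hN j))
        simp only [A, map_prod, eval_linearForm]
        exact Finset.prod_ne_zero_iff.mpr fun i _ => hL1 i j i.2
      · convert hsum using 1
        refine Finset.sum_congr rfl fun a _ => ?_
        simp only [V, Φ, map_mul, map_pow, Polynomial.smul_eq_C_mul]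
        rw [hr, restrictLine_linearForm (hM0 j)]
        ring
    · refine Finset.dvd_sum fun i hij => Finset.dvd_sum fun a _ => ?_
      have hij : j ≠ i := fun h => by simp [h] at hij
      rw [Polynomial.smul_eq_C_mul]
      simp only [Φ, map_mul, map_pow]
      refine Dvd.dvd.mul_left (Dvd.dvd.mul_right (Dvd.dvd.mul_right (pow_dvd_pow_of_dvd ?_ p) _) _) _
      simp only [A, map_prod]
      refine Dvd.dvd.trans ?_ (Finset.dvd_prod_of_mem _ (Finset.mem_univ ⟨j, hij⟩))
      rw [hr, restrictLine_linearForm (hL0 j i hij)]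
      exact dvd_mul_right _ _
  -- The Koszul syzygies B ↦ (-GB, FB); F is prime and does not divide G, so these are the only
  -- relations between F and G.
  let U : W l →ₗ[K] ((ι × Fin p → K) × (W (e + l) × W (d + l))) :=
    (0 : W l →ₗ[K] (ι × Fin p → K)).prod
      ((((LinearMap.mulLeft K (-G)).domRestrict (W l)).codRestrict (W (e + l))
          fun x => hG.neg.mul x.2).prod
        (((LinearMap.mulLeft K F).domRestrict (W l)).codRestrict (W (d + l))
          fun x => hF.mul x.2))
  have hker : LinearMap.ker T ≤ LinearMap.range U := by
    intro x hx
    have h0 := hindep x hx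
    have h1 : F * x.2.1 + G * x.2.2 = 0 := by
      have := (hT x).symm.trans hx
      simpa [h0] using this
    obtain ⟨B, hB⟩ : F ∣ (x.2.2 : MvPolynomial (Fin 3) K) := by
      refine (hi.prime.dvd_or_dvd (a := G) ⟨-x.2.1, ?_⟩).resolve_left hFG
      linear_combination h1
    have hBl : B.IsHomogeneous l := by
      have := hF.of_mul_right hi.ne_zero (n := d + l) (B := B) (by rw [← hB]; exact x.2.2.2)
        (by omega)
      simpa using this
    have hA1 : (x.2.1 : MvPolynomial (Fin 3) K) = -G * B := by
      refine mul_left_cancel₀ hi.ne_zero ?_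
      rw [hB] at h1
      linear_combination h1
    refine ⟨⟨B, hBl⟩, ?_⟩
    refine Prod.ext h0.symm (Prod.ext (Subtype.ext ?_) (Subtype.ext ?_))
    · exact hA1.symm
    · exact hB.symm
  have h1 := LinearMap.finrank_range_add_finrank_ker T
  have h2 := Submodule.finrank_mono hrange
  have h3 := (Submodule.finrank_mono hker).trans (LinearMap.finrank_range_le U)
  simp only [Module.finrank_prod, Module.finrank_fintype_fun_eq_card, Fintype.card_prod,
    Fintype.card_fin] at h1
  have e1 := two_mul_finrank_homogeneousSubmodule (K := K) n
  have e2 := two_mul_finrank_homogeneousSubmodule (K := K) l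
  have e3 := two_mul_finrank_homogeneousSubmodule (K := K) (e + l)
  have e4 := two_mul_finrank_homogeneousSubmodule (K := K) (d + l)
  change 2 * Module.finrank K (W _) = _ at e1 e2 e3 e4
  rw [← hm] at h1
  -- Twice the bound pm ≤ dim W(n) - dim W(e+l) - dim W(d+l) + dim W(l), whose right side equals de.
  have hfin : 2 * (m * p) + ((e + l + 1) * (e + l + 2) + (d + l + 1) * (d + l + 2)) ≤
      (n + 1) * (n + 2) + (l + 1) * (l + 2) := by omega
  rw [hn] at hfin
  nlinarith

end Bezout

/-! ### Intersection of a smooth curve with a line -/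

section Lines

variable {K : Type*} [Field K]

theorem exists_dotProduct_eq_zero_forall_ne_smul {a P : Fin 3 → K} (ha : a ≠ 0) :
    ∃ Q, a ⬝ᵥ Q = 0 ∧ ∀ c : K, Q ≠ c • P := by
  by_contra! h
  obtain ⟨i, hi⟩ := Function.ne_iff.mp ha
  have hi : a i ≠ 0 := hi
  obtain ⟨α, hα⟩ := h (a i • Pi.single (i + 1) 1 - a (i + 1) • Pi.single i 1) (by simp; ring)
  obtain ⟨β, hβ⟩ := h (a i • Pi.single (i + 2) 1 - a (i + 2) • Pi.single i 1) (by simp; ring)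
  have h1 := congrFun hα (i + 1)
  have h2 := congrFun hα (i + 2)
  have h3 := congrFun hβ (i + 2)
  fin_cases i <;> simp at h1 h2 h3 hi <;> grind

theorem exists_eq_smul_add_smul {a P Q v : Fin 3 → K} (ha : a ≠ 0) (hP : a ⬝ᵥ P = 0)
    (hQ : a ⬝ᵥ Q = 0) (hQ0 : Q ≠ 0) (hPQ : ∀ c : K, P ≠ c • Q) (hv : a ⬝ᵥ v = 0) :
    ∃ α β : K, v = α • P + β • Q := by
  obtain ⟨u, huQ, huP⟩ := exists_dotProduct_eq_zero_ne_zero hQ0 hPQ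
  obtain ⟨β, hβ⟩ := exists_eq_smul_of_orthogonal (w := v - (u ⬝ᵥ v / u ⬝ᵥ P) • P) hQ0 hQ hP
    (by rw [dotProduct_sub, dotProduct_smul, hv, hP, smul_zero, sub_zero]) ha huQ huP
    (by rw [dotProduct_sub, dotProduct_smul, smul_eq_mul, div_mul_cancel₀ _ huP, sub_self])
  exact ⟨_, β, by rw [← hβ, add_sub_cancel]⟩

theorem MvPolynomial.IsHomogeneous.natDegree_restrictLine_le {F : MvPolynomial (Fin 3) K} {d : ℕ}
    (hF : F.IsHomogeneous d) (P Q : Fin 3 → K) :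
    (restrictLine P Q F).natDegree ≤ d ∧ (restrictLine P Q F).coeff d = eval Q F := by
  have hl : ∀ i, (Polynomial.C (P i) + Polynomial.X * Polynomial.C (Q i)).natDegree ≤ 1 := by
    intro i
    compute_degree
  have hc : ∀ i, (Polynomial.C (P i) + Polynomial.X * Polynomial.C (Q i)).coeff 1 = Q i := by
    intro i
    simp [Polynomial.coeff_C]
  have hm : ∀ m ∈ F.support, (restrictLine P Q (monomial m (F.coeff m))).natDegree ≤ d ∧
      (restrictLine P Q (monomial m (F.coeff m))).coeff d = eval Q (monomial m (F.coeff m)) := by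
    intro m hmF
    have hd : d = 0 + (m 0 * 1 + m 1 * 1 + m 2 * 1) := by
      have := hF (mem_support_iff.mp hmF)
      have h1 : m.degree = d := by rw [← this, Finsupp.degree_eq_weight_one]; rfl
      simp [Finsupp.degree_eq_sum, Fin.sum_univ_three] at h1
      omega
    have hp : ∀ i, ((Polynomial.C (P i) + Polynomial.X * Polynomial.C (Q i)) ^ m i).natDegree ≤
        m i * 1 := fun i => Polynomial.natDegree_pow_le_of_le _ (hl i)
    have h2 := (Polynomial.natDegree_mul_le_of_le (hp 0) (hp 1))
    have h3 := (Polynomial.natDegree_mul_le_of_le h2 (hp 2))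
    rw [restrictLine, aeval_monomial, eval_monomial, Finsupp.prod_fintype _ _ (by simp),
      Finsupp.prod_fintype _ _ (by simp), Fin.prod_univ_three, Fin.prod_univ_three,
      Polynomial.algebraMap_eq, hd]
    refine ⟨Polynomial.natDegree_mul_le_of_le (by simp) h3, ?_⟩
    rw [Polynomial.coeff_mul_add_eq_of_natDegree_le (by simp) h3,
      Polynomial.coeff_mul_add_eq_of_natDegree_le h2 (hp 2),
      Polynomial.coeff_mul_add_eq_of_natDegree_le (hp 0) (hp 1)]
    simp only [Polynomial.coeff_pow_of_natDegree_le (hl _), hc, Polynomial.coeff_C_zero]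
  have hs : F = ∑ m ∈ F.support, monomial m (F.coeff m) := F.as_sum
  rw [congrArg (restrictLine P Q) hs, congrArg (eval Q) hs, map_sum, map_sum]
  refine ⟨Polynomial.natDegree_sum_le_of_forall_le _ _ fun m h => (hm m h).1, ?_⟩
  rw [Polynomial.finsetSum_coeff]
  exact Finset.sum_congr rfl fun m h => (hm m h).2

/-- A smooth plane curve of degree at least two contains no line. -/
theorem MvPolynomial.IsSmoothForm.exists_eval_ne_zero [IsAlgClosed K] {F : MvPolynomial (Fin 3) K}
    {d : ℕ} (hs : F.IsSmoothForm) (hF : F.IsHomogeneous d) (hd : 1 < d) {a : Fin 3 → K}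
    (ha : a ≠ 0) : ∃ Q, a ⬝ᵥ Q = 0 ∧ eval Q F ≠ 0 := by
  by_contra! h
  obtain ⟨j, hj⟩ := Function.ne_iff.mp ha
  have hj : a j ≠ 0 := hj
  -- If F vanished on the line, its gradient there would be a multiple of `a`. At a zero of the j-th
  -- partial on the line, `a j ≠ 0` makes this multiple zero, so the point is singular.
  obtain ⟨v, hv0, hav, hjv⟩ := exists_common_zero
    ((isHomogeneous_linearForm a).eval_zero_eq_zero one_ne_zero)
    ((hF.pderiv (i := j)).eval_zero_eq_zero (by omega))
  rw [eval_linearForm] at hav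
  obtain ⟨c, hc⟩ := exists_eq_smul_of_dotProduct (b := grad F v) ha fun w hw => by
    have h0 : restrictLine v w F = 0 := Polynomial.funext fun t => by
      rw [eval_restrictLine, Polynomial.eval_zero]
      exact h _ (by rw [dotProduct_add, dotProduct_smul, hav, hw, smul_zero, add_zero])
    have h1 := congrArg (Polynomial.eval 0) (derivative_restrictLine v w F)
    rw [h0, Polynomial.derivative_zero, Polynomial.eval_zero, Polynomial.eval_finsetSum] at h1
    simpa [eval_restrictLine, grad, dotProduct] using h1.symm
  have hcj : grad F v j = c * a j := by rw [hc]; rfl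
  rw [show grad F v j = 0 from hjv, eq_comm, mul_eq_zero, or_iff_left hj] at hcj
  exact hs v hv0 (h v hav) (by rw [hc, hcj, zero_smul])

/-- The points of a plane curve on a line correspond to the roots of the restriction of the
equation to the line, for a parametrization whose point at infinity is not on the curve. -/
theorem Plane.encard_zeros_inter_line [DecidableEq K] {F : MvPolynomial (Fin 3) K} {d : ℕ}
    (hF : F.IsHomogeneous d) (hd : d ≠ 0) {a P Q : Fin 3 → K} (ha : a ≠ 0) (hP : a ⬝ᵥ P = 0)
    (hQ : a ⬝ᵥ Q = 0) (hPQ : ∀ c : K, P ≠ c • Q) (hQF : eval Q F ≠ 0) :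
    (zeros F ∩ {x | a ⬝ᵥ x.rep = 0}).encard = (restrictLine P Q F).roots.toFinset.card := by
  have hQ0 : Q ≠ 0 := by
    rintro rfl
    exact hQF (hF.eval_zero_eq_zero hd)
  have hr0 : restrictLine P Q F ≠ 0 := by
    intro h
    have := (hF.natDegree_restrictLine_le P Q).2
    rw [h, Polynomial.coeff_zero] at this
    exact hQF this.symm
  obtain ⟨u, huQ, huP⟩ := exists_dotProduct_eq_zero_ne_zero hQ0 hPQ
  have hne : ∀ t : K, P + t • Q ≠ 0 := by
    intro t h
    have := congrArg (u ⬝ᵥ ·) h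
    simp only [dotProduct_add, dotProduct_smul, huQ, smul_zero, add_zero, dotProduct_zero] at this
    exact huP this
  let φ : K → Plane K := fun t => Projectivization.mk K (P + t • Q) (hne t)
  have hφ : Function.Injective φ := by
    intro t s hts
    obtain ⟨c, hc⟩ := (Projectivization.mk_eq_mk_iff' _ _ _ _ _).mp hts
    have h1 := congrArg (u ⬝ᵥ ·) hc
    simp only [dotProduct_add, dotProduct_smul, huQ, smul_eq_mul] at h1
    have hc1 : c = 1 := by
      have : (c - 1) * (u ⬝ᵥ P) = 0 := by linear_combination h1
      exact sub_eq_zero.mp ((mul_eq_zero.mp this).resolve_right huP)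
    rw [hc1, one_smul, add_right_inj] at hc
    exact (smul_left_injective K hQ0 hc).symm
  have himage : zeros F ∩ {x | a ⬝ᵥ x.rep = 0} = φ '' (restrictLine P Q F).roots.toFinset := by
    ext x
    simp only [Set.mem_inter_iff, Set.mem_image, SetLike.mem_coe, Multiset.mem_toFinset,
      Polynomial.mem_roots hr0, Polynomial.IsRoot.def, eval_restrictLine]
    constructor
    · rintro ⟨hx, hxa⟩
      have hx : eval x.rep F = 0 := hx
      obtain ⟨α, β, hαβ⟩ := exists_eq_smul_add_smul ha hP hQ hQ0 hPQ hxa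
      have hα : α ≠ 0 := by
        rintro rfl
        rw [zero_smul, zero_add] at hαβ
        rw [hαβ, hF.eval_smul, mul_eq_zero, or_iff_left hQF] at hx
        apply x.rep_nonzero
        rw [hαβ, eq_zero_of_pow_eq_zero hx, zero_smul]
      have e : x.rep = α • (P + (β / α) • Q) := by
        rw [hαβ, smul_add, smul_smul, mul_div_cancel₀ _ hα]
      refine ⟨β / α, ?_, ?_⟩
      · rw [e, hF.eval_smul, mul_eq_zero] at hx
        exact hx.resolve_left (pow_ne_zero d hα)
      · rw [← x.mk_rep]
        exact (Projectivization.mk_eq_mk_iff' _ _ _ _ _).mpr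
          ⟨α⁻¹, by rw [e, inv_smul_smul₀ hα]⟩
    · rintro ⟨t, ht, rfl⟩
      refine ⟨(eval_rep_mk hF _ (hne t)).mpr ht, ?_⟩
      obtain ⟨c, -, hc⟩ := exists_rep_mk _ (hne t)
      change a ⬝ᵥ (φ t).rep = 0
      rw [hc, dotProduct_smul, dotProduct_add, dotProduct_smul, hP, hQ]
      simp
  rw [himage, hφ.encard_image, Set.encard_coe_eq_coe_finsetCard]

/-- A line which is nowhere tangent to a smooth plane curve of degree `d` meets it in `d`
points. -/
theorem Plane.encard_zeros_inter_line_eq [IsAlgClosed K] {F : MvPolynomial (Fin 3) K} {d : ℕ}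
    (hF : F.IsHomogeneous d) (hd : 1 < d) (hs : F.IsSmoothForm) {a : Fin 3 → K} (ha : a ≠ 0)
    (h : ∀ P ∈ zeros F, ∀ c : K, grad F P.rep ≠ c • a) :
    (zeros F ∩ {x | a ⬝ᵥ x.rep = 0}).encard = d := by
  classical
  obtain ⟨Q, hQ, hQF⟩ := hs.exists_eval_ne_zero hF hd ha
  obtain ⟨P, hP, hPQ⟩ := exists_dotProduct_eq_zero_forall_ne_smul (P := Q) ha
  have hQ0 : Q ≠ 0 := by
    rintro rfl
    exact hQF (hF.eval_zero_eq_zero (by omega))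
  obtain ⟨hle, hco⟩ := hF.natDegree_restrictLine_le P Q
  set g := restrictLine P Q F with hg
  have hdeg : g.natDegree = d :=
    le_antisymm hle (Polynomial.le_natDegree_of_ne_zero (by rwa [hco]))
  have hg0 : g ≠ 0 := by
    rintro h0
    rw [h0, Polynomial.coeff_zero] at hco
    exact hQF hco.symm
  -- At a repeated root the gradient kills the direction Q, and by Euler's relation the point
  -- itself, hence the whole line: the line is tangent there.
  have hnodup : g.roots.Nodup := by
    rw [Multiset.nodup_iff_count_le_one]
    intro t
    by_contra! hlt
    rw [Polynomial.count_roots, Polynomial.one_lt_rootMultiplicity_iff_isRoot hg0,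
      Polynomial.IsRoot.def, Polynomial.IsRoot.def, hg, derivative_restrictLine, eval_restrictLine,
      Polynomial.eval_finsetSum] at hlt
    obtain ⟨h1, h2⟩ := hlt
    simp only [Polynomial.eval_mul, eval_restrictLine, Polynomial.eval_C] at h2
    change grad F (P + t • Q) ⬝ᵥ Q = 0 at h2
    have hne : P + t • Q ≠ 0 := by
      intro h0
      exact hPQ (-t) (by rw [neg_smul]; exact eq_neg_of_add_eq_zero_left h0)
    have h3 := hF.dotProduct_grad (P + t • Q)
    rw [h1, mul_zero, dotProduct_add, dotProduct_smul, h2, smul_zero, add_zero] at h3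
    obtain ⟨c, hc⟩ := exists_eq_smul_of_dotProduct (b := grad F (P + t • Q)) ha fun v hv => by
      obtain ⟨α, β, rfl⟩ := exists_eq_smul_add_smul ha hP hQ hQ0 hPQ hv
      rw [dotProduct_add, dotProduct_smul, dotProduct_smul, h2, h3, smul_zero, smul_zero, add_zero]
    obtain ⟨b, -, hb⟩ := exists_rep_mk _ hne
    refine h (Projectivization.mk K _ hne) ((eval_rep_mk hF _ hne).mpr h1) (b ^ (d - 1) * c) ?_
    rw [hb, hF.grad_smul, hc, smul_smul]
  rw [encard_zeros_inter_line hF (by omega) ha hP hQ hPQ hQF,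
    Multiset.toFinset_card_of_nodup hnodup,
    IsAlgClosed.card_roots_eq_natDegree, hdeg]

end Lines

/-! ### Bounds for tangent lines of a flat curve -/

section Flat

/-- The polar of a point with respect to a smooth curve of degree `d ≡ 1` is nonzero. -/
theorem MvPolynomial.IsSmoothForm.sum_C_mul_pderiv_ne_zero {K : Type*} [Field K] [IsAlgClosed K]
    {F : MvPolynomial (Fin 3) K} {d : ℕ} (hs : F.IsSmoothForm)
    (hF : F.IsHomogeneous d) (hd : 1 < d) (hd1 : (d : K) = 1) {R : Fin 3 → K} (hR : R ≠ 0) :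
    ∑ i, C (R i) * pderiv i F ≠ 0 := by
  intro h
  obtain ⟨j, hj⟩ := Function.ne_iff.mp hR
  have hj : R j ≠ 0 := hj
  -- At a common zero of two partials, the assumed relation with `R j ≠ 0` kills the third. As d = 1
  -- in K, Euler's relation puts the point on the curve, where it is singular.
  obtain ⟨v, hv0, h1, h2⟩ := exists_common_zero
    ((hF.pderiv (i := j + 1)).eval_zero_eq_zero (by omega))
    ((hF.pderiv (i := j + 2)).eval_zero_eq_zero (by omega))
  have h3 := congrArg (eval v) h
  rw [Fin.sum_univ_three] at h3
  have hz : grad F v = 0 := by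
    ext i
    change eval v (pderiv i F) = 0
    fin_cases j <;> simp at h1 h2 hj <;> fin_cases i <;> simp_all
  have h4 := hF.dotProduct_grad v
  rw [hz, zero_dotProduct, hd1, one_mul] at h4
  exact hs v hv0 h4.symm hz
variable {K : Type*} [Field K] [IsAlgClosed K] {p : ℕ} [CharP K p] {F : MvPolynomial (Fin 3) K}
  {d : ℕ}

/-- A tangent line of a flat smooth curve of degree `d` in characteristic `p` meets it in at most
`d - p + 1` points. -/
theorem Plane.encard_zeros_inter_tangent_line_le (hp : p ≠ 0) (hflat : F.IsFlat) (h2 : (2 : K) ≠ 0)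
    (hF : F.IsHomogeneous d) (hd : 1 < d) (hi : Irreducible F)
    (hs : F.IsSmoothForm) {a : Fin 3 → K} (ha : a ≠ 0) {P : Plane K} (hP : P ∈ zeros F) {c : K}
    (hc : grad F P.rep = c • a) : (zeros F ∩ {x | a ⬝ᵥ x.rep = 0}).encard ≤ (d - p + 1 : ℕ) := by
  classical
  have hP : eval P.rep F = 0 := hP
  obtain ⟨Q, hQ, hQF⟩ := hs.exists_eval_ne_zero hF hd ha
  have hg := hs _ P.rep_nonzero hP
  have hc0 : c ≠ 0 := by
    rintro rfl
    exact hg (by rw [hc, zero_smul])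
  have haP : a ⬝ᵥ P.rep = 0 := by
    have := hF.dotProduct_grad P.rep
    rw [hP, mul_zero, hc, smul_dotProduct, smul_eq_mul, mul_eq_zero] at this
    exact this.resolve_left hc0
  have hPQ : ∀ b : K, P.rep ≠ b • Q := by
    intro b hb
    rw [hb, hF.eval_smul, mul_eq_zero, or_iff_left hQF] at hP
    apply P.rep_nonzero
    rw [hb, eq_zero_of_pow_eq_zero hP, zero_smul]
  rw [encard_zeros_inter_line hF (by omega) ha haP hQ hPQ hQF]
  obtain ⟨hle, hco⟩ := hF.natDegree_restrictLine_le P.rep Q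
  obtain ⟨j, hj⟩ := Function.ne_iff.mp hg
  -- Contact p at P leaves a cofactor of degree at most d - p, so besides P there are at most d - p
  -- intersection points.
  obtain ⟨⟨h, hh⟩, -⟩ := hflat.pow_dvd_restrictLine (p := p) h2 hF hd hi hP
    (by rw [hc, smul_dotProduct, hQ, smul_zero]) hj
  rw [hh] at hle hco ⊢
  have hh0 : h ≠ 0 := by
    rintro rfl
    rw [mul_zero, Polynomial.coeff_zero] at hco
    exact hQF hco.symm
  rw [Polynomial.natDegree_X_pow_mul _ hh0] at hle
  rw [Polynomial.roots_mul (mul_ne_zero (pow_ne_zero _ Polynomial.X_ne_zero) hh0),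
    Polynomial.roots_X_pow, Multiset.toFinset_add, Multiset.toFinset_nsmul _ _ hp]
  norm_cast
  refine (Finset.card_union_le _ _).trans ?_
  have h1 := (Multiset.toFinset_card_le h.roots).trans h.card_roots'
  rw [Multiset.toFinset_singleton, Finset.card_singleton]
  omega

/-- In characteristic `p`, at most `d (d - 1) / p` tangent lines of a flat smooth curve of degree
`d` pass through a given point, counted by points of tangency. -/
theorem Plane.mul_card_le_of_tangent (hflat : F.IsFlat) (h2 : (2 : K) ≠ 0)
    (hF : F.IsHomogeneous d) (hd : 1 < d) (hd1 : (d : K) = 1) (hi : Irreducible F)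
    (hs : F.IsSmoothForm) {R : Fin 3 → K} (hR : R ≠ 0) (s : Finset (Plane K))
    (hsF : ∀ P ∈ s, P ∈ zeros F ∧ grad F P.rep ⬝ᵥ R = 0) : p * s.card ≤ d * (d - 1) := by
  have hG0 := hs.sum_C_mul_pderiv_ne_zero hF hd hd1 hR
  have hG : (∑ i, C (R i) * pderiv i F).IsHomogeneous (d - 1) :=
    IsHomogeneous.sum _ _ _ fun i _ => hF.pderiv.C_mul _
  have hFG : ¬ F ∣ ∑ i, C (R i) * pderiv i F :=
    hF.not_dvd hG0 (hG.totalDegree_le.trans_lt (by omega))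
  have hg : ∀ P : s, grad F P.1.rep ≠ 0 := fun P => hs _ P.1.rep_nonzero (hsF P P.2).1
  choose Q hQ hPQ using fun P : s =>
    exists_dotProduct_eq_zero_forall_ne_smul (P := P.1.rep) (hg P)
  have key := fun (P : s) {j : Fin 3} (hj : grad F P.1.rep j ≠ 0) =>
    hflat.pow_dvd_restrictLine (p := p) h2 hF hd hi (hsF P P.2).1 (hQ P) hj
  have := mul_card_le_of_pow_dvd_restrictLine (p := p) hF hG hi hFG (fun P : s => P.1.rep) Q
    (fun P => P.1.rep_nonzero) hPQ ?_ ?_ ?_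
  · simpa using this
  · intro i j hij c hc
    exact hij (Subtype.ext (Plane.eq_of_rep_eq_smul hc).symm)
  · intro P
    obtain ⟨j, hj⟩ := Function.ne_iff.mp (hg P)
    exact (key P hj).1
  · intro P
    obtain ⟨j, hj⟩ := Function.ne_iff.mp (hg P)
    have hun : IsUnit (Polynomial.C (grad F P.1.rep j)) := by simpa using hj
    have hPR := congrArg Polynomial.C (hsF P P.2).2
    simp only [dotProduct, Fin.sum_univ_three, map_add, map_mul, map_zero] at hPR
    have hr : ∀ b, restrictLine P.1.rep (Q P) (C b) = Polynomial.C b := fun b => by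
      simp [restrictLine]
    choose w hw using (key P hj).2
    rw [← hun.dvd_mul_left]
    simp only [Fin.sum_univ_three, map_add, map_mul, hr]
    -- Modulo X^p the gradient along the tangent line is proportional to its value at P, which is
    -- orthogonal to R; so the polar of R vanishes to order p.
    refine ⟨∑ i, Polynomial.C (R i) * w i, ?_⟩
    rw [Fin.sum_univ_three]
    linear_combination Polynomial.C (R 0) * hw 0 + Polynomial.C (R 1) * hw 1 +
      Polynomial.C (R 2) * hw 2 + restrictLine P.1.rep (Q P) (pderiv j F) * hPR

end Flat

/-! ### Rational points, double counting and Frobenius -/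

section Rational

variable {k : Type*} [Field k]

theorem FiniteField.mem_range_algebraMap_of_pow_card_eq [Fintype k] {K : Type*} [Field K]
    [Algebra k K] {x : K} (hx : x ^ Fintype.card k = x) : x ∈ Set.range (algebraMap k K) := by
  classical
  have h1 := FiniteField.X_pow_card_sub_X_natDegree_eq k (Fintype.one_lt_card (α := k))
  have hm : (Polynomial.X ^ Fintype.card k - Polynomial.X : Polynomial k).Monic := by
    refine Polynomial.monic_X_pow_sub ?_
    rw [Polynomial.degree_X]
    exact_mod_cast Fintype.one_lt_card (α := k)
  have h2 := Polynomial.prod_multiset_X_sub_C_of_monic_of_roots_card_eq hm (by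
    rw [FiniteField.roots_X_pow_card_sub_X, h1]; rfl)
  rw [FiniteField.roots_X_pow_card_sub_X] at h2
  have h3 := congrArg (Polynomial.aeval x) h2
  change Polynomial.aeval x (∏ c : k, (Polynomial.X - Polynomial.C c)) = _ at h3
  rw [map_prod, map_sub, map_pow, Polynomial.aeval_X, hx, sub_self, Finset.prod_eq_zero_iff] at h3
  obtain ⟨c, -, hc⟩ := h3
  refine ⟨c, ?_⟩
  rw [map_sub, Polynomial.aeval_X, Polynomial.aeval_C] at hc
  exact (sub_eq_zero.mp hc).symm

/-- The number of lines through a point of a finite projective plane. -/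
theorem Plane.card_orthogonal [Fintype k] (a : Plane k) :
    Nat.card {b : Plane k // Projectivization.orthogonal a b} = Fintype.card k + 1 := by
  classical
  have : Finite (Plane k) := inferInstance
  have := Fintype.ofFinite (Plane k)
  have h1 := Configuration.ProjectivePlane.card_points (Plane k) (Plane k)
  have h2 := Configuration.ProjectivePlane.lineCount_eq (P := Plane k) (Plane k) a
  rw [← Nat.card_eq_fintype_card, Projectivization.card_of_finrank k (Fin 3 → k) (n := 3) (by simp),
    Finset.sum_range_succ, Finset.sum_range_succ, Finset.sum_range_one, Nat.card_eq_fintype_card]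
    at h1
  have h3 : Configuration.ProjectivePlane.order (Plane k) (Plane k) = Fintype.card k := by
    nlinarith
  rw [h3] at h2
  exact h2

/-- Here `V` serves both as points and as lines, `τ` counts tangencies and `N` holds the rational
points of the curve. Summing `h1` over points and `h2` over lines bounds the averages of `τ` and of
the indicator of `N`; by `h3` and `h4` these averages add up to at least 2. -/
theorem Finset.double_count_tangents {V : Type*} [Fintype V] [Nonempty V] (I : V → V → Prop)
    [DecidableRel I] (hI : ∀ a b, I a b ↔ I b a) {c : ℕ}
    (hc : ∀ a, (univ.filter (I a)).card = c) (N : Finset V) (τ : V → ℕ) {B p n : ℕ}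
    (h1 : ∀ R, p * ∑ a ∈ univ.filter (I R), τ a ≤ B)
    (h2 : ∀ a, (N.filter (I a)).card ≤ n)
    (h3 : (univ.filter fun a => τ a = 1).card ≤ N.card) (h4 : ∀ a, τ a ≠ 0) :
    2 * p * c ≤ B + p * n := by
  have e1 : c * N.card ≤ Fintype.card V * n := by
    have : ∑ a, (N.filter (I a)).card = ∑ R ∈ N, (univ.filter (I R)).card := by
      simp only [card_filter]
      rw [sum_comm]
      exact sum_congr rfl fun R _ => sum_congr rfl fun a _ => by simp only [hI a R]
    rw [sum_congr rfl fun R _ => hc R, sum_const, smul_eq_mul] at this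
    rw [mul_comm, ← this]
    simpa using sum_le_card_nsmul univ _ n fun a _ => h2 a
  have e2 : p * (c * ∑ a, τ a) ≤ Fintype.card V * B := by
    have : ∑ R, ∑ a ∈ univ.filter (I R), τ a = c * ∑ a, τ a := by
      simp only [sum_filter]
      rw [sum_comm, mul_sum]
      refine sum_congr rfl fun a _ => ?_
      rw [← sum_filter, sum_const, smul_eq_mul]
      congr 1
      rw [← hc a]
      congr 1
      ext R
      simp [hI a R]
    rw [← this, mul_sum]
    simpa using sum_le_card_nsmul univ _ B fun R _ => h1 R
  have e3 : 2 * Fintype.card V ≤ ∑ a, τ a + N.card := by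
    refine le_trans ?_ (Nat.add_le_add_left h3 _)
    rw [card_filter, ← sum_add_distrib, mul_comm, ← smul_eq_mul, ← card_univ, ← sum_const]
    refine sum_le_sum fun a _ => ?_
    have := h4 a
    split_ifs <;> omega
  have hV : 0 < Fintype.card V := Fintype.card_pos
  refine Nat.le_of_mul_le_mul_left ?_ hV
  calc Fintype.card V * (2 * p * c) = p * c * (2 * Fintype.card V) := by ring
    _ ≤ p * c * (∑ a, τ a + N.card) := Nat.mul_le_mul_left _ e3
    _ = p * (c * ∑ a, τ a) + p * (c * N.card) := by ring
    _ ≤ Fintype.card V * B + p * (Fintype.card V * n) :=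
      Nat.add_le_add e2 (Nat.mul_le_mul_left _ e1)
    _ = _ := by ring

variable (K : Type*) [Field K] [Algebra k K]

theorem algebraMap_comp_dotProduct (a b : Fin 3 → k) :
    (algebraMap k K ∘ a) ⬝ᵥ (algebraMap k K ∘ b) = algebraMap k K (a ⬝ᵥ b) := by
  simp [dotProduct]

theorem algebraMap_comp_ne_zero {a : Fin 3 → k} (ha : a ≠ 0) : algebraMap k K ∘ a ≠ 0 := by
  obtain ⟨i, hi⟩ := Function.ne_iff.mp ha
  exact Function.ne_iff.mpr ⟨i, by simpa using hi⟩

variable {K}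

theorem Plane.eq_of_algebraMap_comp_eq_smul {a b : Plane k} {c : K}
    (h : algebraMap k K ∘ a.rep = c • (algebraMap k K ∘ b.rep)) : a = b := by
  obtain ⟨i, hi⟩ := Function.ne_iff.mp b.rep_nonzero
  have hi : b.rep i ≠ 0 := hi
  have hi' : algebraMap k K (b.rep i) ≠ 0 := by simpa using hi
  have hc : c = algebraMap k K (a.rep i / b.rep i) := by
    have := congrFun h i
    simp only [Function.comp_apply, Pi.smul_apply, smul_eq_mul] at this
    rw [map_div₀, this, mul_div_cancel_right₀ _ hi']
  refine eq_of_rep_eq_smul (c := a.rep i / b.rep i) ?_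
  ext j
  apply (algebraMap k K).injective
  have := congrFun h j
  rw [hc] at this
  simpa using this

/-- The inclusion of the `k`-rational points. -/
noncomputable def Plane.baseChange (K : Type*) [Field K] [Algebra k K] (a : Plane k) : Plane K :=
  Projectivization.mk K (algebraMap k K ∘ a.rep) (algebraMap_comp_ne_zero K a.rep_nonzero)

theorem Plane.baseChange_injective : Function.Injective (Plane.baseChange (k := k) K) := by
  intro a b h
  obtain ⟨c, hc⟩ := (Projectivization.mk_eq_mk_iff' _ _ _ _ _).mp h
  exact eq_of_algebraMap_comp_eq_smul hc.symm

theorem MvPolynomial.eval_map_algHom (φ : K →ₐ[k] K) (f : MvPolynomial (Fin 3) k)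
    (v : Fin 3 → K) : eval (φ ∘ v) (map (algebraMap k K) f) =
      φ (eval v (map (algebraMap k K) f)) := by
  rw [eval_map, eval_map, ← aeval_def, ← aeval_def]
  exact (congrArg (· f) (comp_aeval v φ)).symm

theorem MvPolynomial.eval_map_algebraMap_comp (f : MvPolynomial (Fin 3) k) (v : Fin 3 → k) :
    eval (algebraMap k K ∘ v) (map (algebraMap k K) f) = algebraMap k K (eval v f) := by
  rw [eval_map, eval₂_comp]

/-- If a line over a finite field has a unique point of tangency with a curve over this field, then
this point is rational. -/
theorem Plane.exists_baseChange_eq_of_unique_tangency [Fintype k] {f : MvPolynomial (Fin 3) k}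
    {d : ℕ} (hf : f.IsHomogeneous d) {a : Fin 3 → k} {P : Plane K}
    (hP : P ∈ zeros (map (algebraMap k K) f)) {c : K}
    (hc : grad (map (algebraMap k K) f) P.rep = c • (algebraMap k K ∘ a))
    (huniq : ∀ Q ∈ zeros (map (algebraMap k K) f), ∀ c : K,
      grad (map (algebraMap k K) f) Q.rep = c • (algebraMap k K ∘ a) → Q = P) :
    ∃ R : Plane k, baseChange K R = P ∧ eval R.rep f = 0 := by
  set F := map (algebraMap k K) f with hF
  have hFh : F.IsHomogeneous d := hf.map _
  have hP : eval P.rep F = 0 := hP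
  obtain ⟨i, hi⟩ := Function.ne_iff.mp P.rep_nonzero
  have hi : P.rep i ≠ 0 := hi
  -- With one coordinate normalized to 1, a projective point fixed by Frobenius has its coordinate
  -- vector fixed, so its entries lie in k.
  set w := (P.rep i)⁻¹ • P.rep with hw
  have hwi : w i = 1 := inv_mul_cancel₀ hi
  have hFw : eval w F = 0 := by rw [hw, hFh.eval_smul, hP, mul_zero]
  let φ := FiniteField.frobeniusAlgHom k K
  have hφi : (φ ∘ w) i = 1 := by rw [Function.comp_apply, hwi, map_one]
  have hφ0 : φ ∘ w ≠ 0 := fun h => by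
    rw [h] at hφi
    exact zero_ne_one hφi
  have hφF : eval (φ ∘ w) F = 0 := by rw [hF, eval_map_algHom, ← hF, hFw, map_zero]
  have hφg : grad F (φ ∘ w) = φ ((P.rep i)⁻¹ ^ (d - 1) * c) • (algebraMap k K ∘ a) := by
    have hg : grad F w = ((P.rep i)⁻¹ ^ (d - 1) * c) • (algebraMap k K ∘ a) := by
      rw [hw, hFh.grad_smul, hc, smul_smul]
    ext j
    have hj := congrFun hg j
    simp only [grad, hF, pderiv_map] at hj ⊢
    rw [eval_map_algHom, hj]
    simp only [Pi.smul_apply, Function.comp_apply, smul_eq_mul, map_mul, AlgHom.commutes]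
  obtain ⟨b, hb, hbr⟩ := exists_rep_mk _ hφ0
  have hmk : Projectivization.mk K (φ ∘ w) hφ0 = P := by
    refine huniq _ ((eval_rep_mk hFh _ hφ0).mpr hφF) (b ^ (d - 1) * φ ((P.rep i)⁻¹ ^ (d - 1) * c)) ?_
    rw [hbr, hFh.grad_smul, hφg, smul_smul]
  rw [hmk] at hbr
  have hfix : φ ∘ w = w := by
    have hbi := congrFun hbr i
    rw [Pi.smul_apply, hφi, smul_eq_mul, mul_one] at hbi
    calc φ ∘ w = b⁻¹ • (b • (φ ∘ w)) := (inv_smul_smul₀ hb _).symm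
      _ = b⁻¹ • P.rep := congrArg _ hbr.symm
      _ = w := by rw [hw, hbi]
  have hrange : ∀ j, w j ∈ Set.range (algebraMap k K) := fun j =>
    FiniteField.mem_range_algebraMap_of_pow_card_eq (congrFun hfix j)
  choose u hu using hrange
  have hu : algebraMap k K ∘ u = w := funext hu
  have hu0 : u ≠ 0 := by
    rintro rfl
    rw [← hu] at hwi
    simp at hwi
  refine ⟨Projectivization.mk k u hu0, ?_, ?_⟩
  · obtain ⟨t, ht, htr⟩ := exists_rep_mk u hu0
    rw [baseChange, ← P.mk_rep, Projectivization.mk_eq_mk_iff']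
    refine ⟨algebraMap k K t * (P.rep i)⁻¹, ?_⟩
    rw [mul_smul, ← hw, ← hu, htr]
    ext j
    simp
  · rw [eval_rep_mk hf]
    apply (algebraMap k K).injective
    rw [← eval_map_algebraMap_comp, hu, ← hF, hFw, map_zero]

end Rational

/-! ### Curves over a finite field and the final count -/

namespace PlaneCurve

variable {k : Type*} [Field k] {d : ℕ}

/-- The equation of `C` over the algebraic closure. -/
noncomputable def geomForm (C : PlaneCurve k d) : MvPolynomial (Fin 3) (AlgebraicClosure k) :=
  map (algebraMap k (AlgebraicClosure k)) C.form

theorem geomForm_isHomogeneous (C : PlaneCurve k d) : C.geomForm.IsHomogeneous d :=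
  C.isHomogeneous.map _

theorem geomForm_ne_zero (C : PlaneCurve k d) : C.geomForm ≠ 0 := fun h =>
  C.ne_zero (map_injective _ (algebraMap k (AlgebraicClosure k)).injective (by
    rw [map_zero]; exact h))

theorem geomPoints_eq_zeros (C : PlaneCurve k d) : C.geomPoints = Plane.zeros C.geomForm := by
  ext P
  rw [geomPoints, Plane.zeros, Set.mem_ofPred_eq, Set.mem_ofPred_eq, geomForm, eval_map, aeval_def]

theorem IsSmooth.geomForm_isSmoothForm {C : PlaneCurve k d} (h : C.IsSmooth) :
    C.geomForm.IsSmoothForm := by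
  intro v hv0 hv hg
  have hP : Projectivization.mk _ v hv0 ∈ C.geomPoints := by
    rw [geomPoints_eq_zeros]
    exact (Plane.eval_rep_mk C.geomForm_isHomogeneous v hv0).mpr hv
  obtain ⟨i, hi⟩ := h _ hP
  obtain ⟨c, -, hc⟩ := Plane.exists_rep_mk v hv0
  apply hi
  rw [aeval_def, ← eval_map, ← pderiv_map, hc]
  change grad C.geomForm (c • v) i = 0
  rw [C.geomForm_isHomogeneous.grad_smul, hg, smul_zero]
  rfl

/-- The geometric points at which the line `a` is tangent to `C`. -/
def tangencyPoints (C : PlaneCurve k d) (a : Plane k) : Set (Plane (AlgebraicClosure k)) :=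
  {P | P ∈ Plane.zeros C.geomForm ∧
    ∃ c : AlgebraicClosure k, grad C.geomForm P.rep = c • (algebraMap k _ ∘ a.rep)}

end PlaneCurve

open PlaneCurve in
/-- If every line over a finite field `k` is somewhere tangent to a flat smooth plane curve of
degree `d` over `k`, then `k` is small compared to `d`. -/
theorem PlaneCurve.card_le_of_forall_not_meetsTransversely {k : Type*} [Field k] [Fintype k]
    {d p : ℕ} [CharP k p] (hp : p ≠ 0) (h2 : (2 : k) ≠ 0) (hd : 1 < d) (hd1 : (d : k) = 1)
    (C : PlaneCurve k d) (hs : C.IsSmooth) (hflat : C.geomForm.IsFlat)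
    (h : ∀ a : Fin 3 → k, a ≠ 0 → ¬ C.MeetsTransversely a) :
    2 * p * (Fintype.card k + 1) ≤ d * (d - 1) + p * (d - p + 1) := by
  classical
  have : CharP (AlgebraicClosure k) p :=
    charP_of_injective_algebraMap (algebraMap k (AlgebraicClosure k)).injective p
  have : Finite (Plane k) := inferInstance
  have := Fintype.ofFinite (Plane k)
  have : Nonempty (Plane k) := ⟨Projectivization.mk k (fun _ => 1) (by
    intro h
    exact one_ne_zero (congrFun h 0))⟩
  set K := AlgebraicClosure k
  have hF := C.geomForm_isHomogeneous
  have hsF := hs.geomForm_isSmoothForm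
  have hi := hsF.irreducible hF (by omega) C.geomForm_ne_zero
  have h2K : (2 : K) ≠ 0 := by
    have := (algebraMap k K).injective.ne h2
    rwa [map_zero, map_ofNat] at this
  have hd1K : (d : K) = 1 := by
    have := congrArg (algebraMap k K) hd1
    simpa using this
  have hbound : ∀ (R : Fin 3 → K), R ≠ 0 → ∀ s : Finset (Plane K),
      (∀ P ∈ s, P ∈ Plane.zeros C.geomForm ∧ grad C.geomForm P.rep ⬝ᵥ R = 0) →
      p * s.card ≤ d * (d - 1) := fun R hR s hs' =>
    Plane.mul_card_le_of_tangent hflat h2K hF hd hd1K hi hsF hR s hs'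
  have hfin : ∀ a, (C.tangencyPoints a).Finite := by
    intro a
    -- Any point R of the line lies on all tangents coinciding with it, so the bound through R makes
    -- the tangency set finite.
    obtain ⟨R, hR, hR0⟩ := exists_dotProduct_eq_zero_forall_ne_smul (P := 0)
      (algebraMap_comp_ne_zero K a.rep_nonzero)
    by_contra hinf
    obtain ⟨s, hsub, hcard⟩ := Set.Infinite.exists_subset_card_eq hinf (d * (d - 1) + 1)
    have := hbound R (by simpa using hR0 0) s fun P hP => by
      obtain ⟨h1, c, hc⟩ := hsub hP
      exact ⟨h1, by rw [hc, smul_dotProduct, hR, smul_zero]⟩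
    rw [hcard] at this
    nlinarith [Nat.pos_of_ne_zero hp]
  let T : Plane k → Finset (Plane K) := fun a => (hfin a).toFinset
  have hT : ∀ a P, P ∈ T a ↔ P ∈ C.tangencyPoints a := fun a P => (hfin a).mem_toFinset
  have hTdisj : ∀ a b P, P ∈ T a → P ∈ T b → a = b := by
    intro a b P ha hb
    obtain ⟨h1, c, hc⟩ := (hT a P).mp ha
    obtain ⟨-, c', hc'⟩ := (hT b P).mp hb
    have hc0 : c ≠ 0 := by
      rintro rfl
      exact hsF _ P.rep_nonzero h1 (by rw [hc, zero_smul])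
    refine Plane.eq_of_algebraMap_comp_eq_smul (K := K) (c := c⁻¹ * c') ?_
    rw [mul_smul, ← hc', hc, inv_smul_smul₀ hc0]
  have horth : ∀ a b : Plane k, Projectivization.orthogonal a b ↔ a.rep ⬝ᵥ b.rep = 0 := by
    intro a b
    conv_lhs => rw [← a.mk_rep, ← b.mk_rep]
    exact Projectivization.orthogonal_mk _ _
  have hne : ∀ a, (T a).Nonempty := by
    intro a
    by_contra hempty
    rw [Finset.not_nonempty_iff_eq_empty] at hempty
    refine h a.rep a.rep_nonzero ?_
    rw [MeetsTransversely, geomPoints_eq_zeros]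
    refine Plane.encard_zeros_inter_line_eq hF hd hsF (algebraMap_comp_ne_zero K a.rep_nonzero)
      fun P hP c hc => ?_
    have : P ∈ T a := (hT a P).mpr ⟨hP, c, hc⟩
    rw [hempty] at this
    exact absurd this (Finset.notMem_empty P)
  refine Finset.double_count_tangents (V := Plane k) Projectivization.orthogonal
    (fun a b => Projectivization.orthogonal_comm) (fun a => ?_)
    (Finset.univ.filter fun R : Plane k => eval R.rep C.form = 0) (fun a => (T a).card)
    (fun R => ?_) (fun a => ?_) ?_ (fun a => (Finset.card_pos.mpr (hne a)).ne')
  · rw [← Plane.card_orthogonal a, Nat.card_eq_fintype_card, Fintype.card_subtype]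
  -- A point of C determines its tangent, so the tangency sets of distinct lines are disjoint and
  -- the bound through R applies to their union.
  · rw [← Finset.card_biUnion fun a _ b _ hab => Finset.disjoint_left.mpr fun P ha hb =>
      hab (hTdisj a b P ha hb)]
    refine hbound (algebraMap k K ∘ R.rep) (algebraMap_comp_ne_zero K R.rep_nonzero) _ ?_
    intro P hP
    obtain ⟨a, ha, hPa⟩ := Finset.mem_biUnion.mp hP
    obtain ⟨h1, c, hc⟩ := (hT a P).mp hPa
    refine ⟨h1, ?_⟩
    rw [hc, smul_dotProduct, algebraMap_comp_dotProduct, dotProduct_comm,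
      (horth R a).mp (Finset.mem_filter.mp ha).2, map_zero, smul_zero]
  · obtain ⟨P, hP⟩ := hne a
    obtain ⟨h1, c, hc⟩ := (hT a P).mp hP
    have hle := Plane.encard_zeros_inter_tangent_line_le hp hflat h2K hF hd hi hsF
      (algebraMap_comp_ne_zero K a.rep_nonzero) h1 hc
    rw [← Finset.card_image_of_injective _ (Plane.baseChange_injective (K := K))]
    rw [← ENat.natCast_le_natCast, ← Set.encard_coe_eq_coe_finsetCard]
    refine (Set.encard_le_encard ?_).trans hle
    intro Q hQ
    rw [Finset.coe_image] at hQ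
    obtain ⟨R, hR, rfl⟩ := hQ
    simp only [Finset.coe_filter, Set.mem_ofPred_eq, Finset.mem_filter, Finset.mem_univ,
      true_and] at hR
    refine ⟨(Plane.eval_rep_mk hF _ _).mpr ?_, ?_⟩
    · rw [geomForm, eval_map_algebraMap_comp, hR.1, map_zero]
    · obtain ⟨t, -, ht⟩ := Plane.exists_rep_mk _ (algebraMap_comp_ne_zero K R.rep_nonzero)
      change _ ⬝ᵥ (Projectivization.mk K _ _).rep = 0
      rw [ht, dotProduct_smul, algebraMap_comp_dotProduct, (horth a R).mp hR.2, map_zero, smul_zero]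
  · have hex : ∀ a ∈ Finset.univ.filter (fun a => (T a).card = 1), ∃ R : Plane k,
        eval R.rep C.form = 0 ∧ Plane.baseChange K R ∈ T a := by
      intro a ha
      obtain ⟨P, hP⟩ := Finset.card_eq_one.mp (Finset.mem_filter.mp ha).2
      have hPT : P ∈ T a := by simp [hP]
      obtain ⟨h1, c, hc⟩ := (hT a P).mp hPT
      obtain ⟨R, hR, hR0⟩ := Plane.exists_baseChange_eq_of_unique_tangency C.isHomogeneous h1 hc
        fun Q hQ b hb => by
          have : Q ∈ T a := (hT a Q).mpr ⟨hQ, b, hb⟩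
          rwa [hP, Finset.mem_singleton] at this
      exact ⟨R, hR0, hR ▸ hPT⟩
    -- The unique tangency point of a line is rational, and it recovers the line, so ρ is injective.
    choose! ρ hρ using hex
    refine Finset.card_le_card_of_injOn ρ (fun a ha => ?_) fun a ha b hb hab => ?_
    · simpa using (hρ a ha).1
    · exact hTdisj a b _ (hρ a ha).2 (hab ▸ (hρ b hb).2)

theorem theorem2 (p r d : ℕ) (hp : p.Prime) (hp2 : 2 < p) (hr : 2 ≤ r)
    (k : Type*) [Field k] [Fintype k] (hk : Fintype.card k = p ^ r)
    (hd : d = p + 1 ∨ d = 2 * p + 1) (C : PlaneCurve k d)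
    (hsmooth : C.IsSmooth) (hnonrefl : ¬ C.IsReflexive) :
    ∃ a : Fin 3 → k, a ≠ 0 ∧ C.MeetsTransversely a := by
  have : Fact p.Prime := ⟨hp⟩
  have : CharP k p := charP_of_card_eq_prime_pow hk
  have : CharP (AlgebraicClosure k) p :=
    charP_of_injective_algebraMap (algebraMap k (AlgebraicClosure k)).injective p
  have hd' : 1 < d := by omega
  have hcast : ∀ (R : Type _) [CommRing R] [CharP R p], (d : R) = 1 := by
    intro R _ _
    rcases hd with rfl | rfl <;> simp
  have h2 : (2 : k) ≠ 0 := by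
    intro h
    have := (CharP.cast_eq_zero_iff k p 2).mp (by exact_mod_cast h)
    exact absurd (Nat.le_of_dvd two_pos this) (by omega)
  have hflat : C.geomForm.IsFlat := by
    by_contra hnf
    apply hnonrefl
    rw [PlaneCurve.IsReflexive, PlaneCurve.geomPoints_eq_zeros]
    have hs := hsmooth.geomForm_isSmoothForm
    exact Plane.isReflexive_zeros (p := p) C.geomForm_isHomogeneous hd' (hcast _)
      (hs.irreducible C.geomForm_isHomogeneous (by omega) C.geomForm_ne_zero) hs hnf
  by_contra! hall
  have hle := PlaneCurve.card_le_of_forall_not_meetsTransversely hp.ne_zero h2 hd' (hcast k) C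
    hsmooth hflat hall
  have hq : p ^ 2 ≤ p ^ r := Nat.pow_le_pow_right hp.pos hr
  rw [hk] at hle
  rcases hd with rfl | rfl
  -- After division by p the bound reads 2(q + 1) ≤ p + 3, impossible for q ≥ p².
  · rw [show p + 1 - p + 1 = 2 by omega, Nat.add_sub_cancel] at hle
    nlinarith
  · rw [show 2 * p + 1 - p + 1 = p + 2 by omega, Nat.add_sub_cancel] at hle
    -- Division by p of 2p(q+1) ≤ (2p+1)·2p + p(p+2). With q ≥ p² it would give 2p² ≤ 5p + 2, false
    -- from p = 3 on.
    have : 2 * (p ^ r + 1) ≤ 5 * p + 4 := by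
      refine le_of_mul_le_mul_left (a := p) ?_ hp.pos
      nlinarith
    nlinarith
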